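/- Let $p$ be a prime and $n \ge 3$. Let $X = \{0,\dots,p-1\}^n$, and let $T_{p,n}$ be the regular rooted tree whose vertices are the finite words over $X$, with root the empty word and with $w$ joined to $wx$ for $x \in X$; the level of a word is its length. Let $\mathrm{Aut}(T_{p,n})$ be the group of graph automorphisms of $T_{p,n}$ that fix the root, with the group topology for which the level stabilizers form a base of neighbourhoods of the identity. Identifying a word $x_0x_1\cdots x_{\ell-1}$ with $\sum_i p^i x_i \in (\mathbb{Z}/p^\ell)^n$, the group $\mathrm{SAff}_n(\mathbb{Z}) = \mathbb{Z}^n \rtimes \mathrm{SL}_n(\mathbb{Z})$ of affine transformations of $\mathbb{Z}^n$ with linear part of determinant $1$ acts on $T_{p,n}$; we identify it with its image in $\mathrm{Aut}(T_{p,n})$. Let $\mathcal{S}_{p,n}$ be the set of infinite sequences $\omega = (\omega_1,\omega_2,\dots)$ over $X \setminus \{0\}$. For $\omega \in \mathcal{S}_{p,n}$ and $g \in \mathrm{Aut}(T_{p,n})$ let $\tilde g^{\omega}$ be the automorphism that fixes the first level and satisfies, for all words $w$, $\tilde g^{\omega}(0w) = 0\,\tilde g^{(\omega_2,\omega_3,\dots)}(w)$,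 $\tilde g^{\omega}(\omega_1 w) = \omega_1 g(w)$, and $\tilde g^{\omega}(xw) = xw$ for $x \in X \setminus\{0,\omega_1\}$. For a subset $\Omega \subseteq \mathcal{S}_{p,n}$ let $\Gamma_{p,n}^{\Omega} \le \mathrm{Aut}(T_{p,n})$ be the subgroup generated by the groups $\langle \mathrm{SAff}_n(\mathbb{Z}) \cup \{\tilde g^{\omega} : g \in \mathrm{SAff}_n(\mathbb{Z})\}\rangle$ with $\omega \in \Omega$. Let $\Omega, \Omega_1, \Omega_2 \subseteq \mathcal{S}_{p,n}$ be non-empty. Then the following hold. (1) The group $\Gamma = \Gamma_{p,n}^{\Omega}$ acts transitively on every level of $T_{p,n}$. It is just infinite, i.e. infinite with all proper quotients finite. It is a branch group, i.e. for every $\ell$ the subgroup generated by the rigid stabilizers of the vertices $v$ of level $\ell$ has finite index in $\Gamma$ (the rigid stabilizer of $v$ consists of the elements of $\Gamma$ that fix $v$ and all words not having $v$ as a prefix). It contains a non-abelian free group. It has the congruence subgroup property, i.e. the canonical homomorphism from its profinite completion $\widehat{\Gamma}$ to its closure $\overline{\Gamma}$ in $\mathrm{Aut}(T_{p,n})$ is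 an isomorphism of profinite groups. In particular $\widehat{\Gamma} \cong \overline{\Gamma}$. Moreover neither the closure nor, up to isomorphism of profinite groups, the profinite completion depends on the set: $\overline{\Gamma_{p,n}^{\Omega_1}} = \overline{\Gamma_{p,n}^{\Omega_2}}$ and $\widehat{\Gamma_{p,n}^{\Omega_1}} \cong \widehat{\Gamma_{p,n}^{\Omega_2}}$. (2) If $\Gamma_{p,n}^{\Omega_1}$ and $\Gamma_{p,n}^{\Omega_2}$ are isomorphic, then they are conjugate in $\mathrm{Aut}(T_{p,n})$. (3) If $\Omega_1 \subseteq \Omega_2$, then the inclusion $\Gamma_{p,n}^{\Omega_1} \to \Gamma_{p,n}^{\Omega_2}$ induces an isomorphism between the profinite completions. -/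

import Mathlib

open CategoryTheory

noncomputable section

/-! ## The rooted tree `T_X` and its automorphism group -/

/-- The regular rooted tree `T_X`: the Cayley graph of the free monoid `X^*` (words over `X`, with
concatenation). Two words are adjacent iff one arises from the other by appending one letter.
The root is the empty word, and the level of a vertex is the length of the word. -/
def wordTree (X : Type*) : SimpleGraph (List X) where
  Adj v w := (∃ x, w = v ++ [x]) ∨ (∃ x, v = w ++ [x])
  symm := ⟨fun _ _ h => h.symm⟩
  loopless := ⟨fun v h => by
    rcases h with ⟨x, h⟩ | ⟨x, h⟩ <;> simpa using congrArg List.length h⟩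

/-- `Aut(T_X)`: the graph automorphisms of `T_X` that fix the root. -/
def treeAut (X : Type*) : Subgroup (Equiv.Perm (List X)) where
  carrier := {α | α [] = [] ∧ ∀ v w, (wordTree X).Adj (α v) (α w) ↔ (wordTree X).Adj v w}
  one_mem' := ⟨rfl, fun _ _ => Iff.rfl⟩
  mul_mem' := by
    rintro α β ⟨ha, ha'⟩ ⟨hb, hb'⟩
    refine ⟨by simp [hb, ha], fun v w => ?_⟩
    rw [Equiv.Perm.mul_apply, Equiv.Perm.mul_apply, ha', hb']
  inv_mem' := by
    rintro α ⟨ha, ha'⟩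
    refine ⟨by rw [Equiv.Perm.inv_eq_iff_eq, ha], fun v w => ?_⟩
    rw [← ha']
    simp

/-- `Aut(T_X)` as a type; it acts on the vertex set `List X` of `T_X`. -/
abbrev TreeAut (X : Type*) : Type _ := ↥(treeAut X)

theorem treeAut_nil {X : Type*} (α : TreeAut X) : α • ([] : List X) = [] := α.2.1

theorem treeAut_inv_smul_eq_iff {X : Type*} {α : TreeAut X} {v w : List X} :
    α⁻¹ • v = w ↔ v = α • w := inv_smul_eq_iff

theorem treeAut_append {X : Type*} (α : TreeAut X) (v : List X) :
    ∀ x : X, ∃ y : X, α • (v ++ [x]) = α • v ++ [y] := by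
  induction v using List.reverseRecOn with
  | nil =>
    intro x
    have h : (wordTree X).Adj (α • ([] : List X)) (α • ([] ++ [x] : List X)) :=
      (α.2.2 _ _).2 (Or.inl ⟨x, rfl⟩)
    rcases h with h | ⟨y, hy⟩
    · exact h
    · rw [treeAut_nil] at hy
      simp at hy
  | append_singleton u z ih =>
    intro x
    have h : (wordTree X).Adj (α • (u ++ [z])) (α • (u ++ [z] ++ [x])) :=
      (α.2.2 _ _).2 (Or.inl ⟨x, rfl⟩)
    rcases h with h | ⟨y, hy⟩
    · exact h
    · obtain ⟨y', hy'⟩ := ih z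
      rw [hy'] at hy
      have h2 := (List.append_inj' hy rfl).1
      have h3 := congrArg List.length (smul_left_cancel α h2)
      simp at h3

theorem treeAut_dropLast {X : Type*} (α : TreeAut X) (v : List X) :
    α • v.dropLast = (α • v).dropLast := by
  induction v using List.reverseRecOn with
  | nil => rw [List.dropLast_nil, treeAut_nil, List.dropLast_nil]
  | append_singleton u z _ =>
    obtain ⟨y, hy⟩ := treeAut_append α u z
    simp [hy]

theorem treeAut_length {X : Type*} (α : TreeAut X) (v : List X) :
    (α • v).length = v.length := by
  induction v using List.reverseRecOn with
  | nil => rw [treeAut_nil]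
  | append_singleton u z ih =>
    obtain ⟨y, hy⟩ := treeAut_append α u z
    simp [hy, ih]

/-- A bijection of the vertex set that is compatible with passing to the parent vertex is an
automorphism of `T_X`. -/
theorem mem_treeAut_of_dropLast {X : Type*} (α : Equiv.Perm (List X))
    (h : ∀ v, α v.dropLast = (α v).dropLast) : α ∈ treeAut X := by
  have hnil : α [] = [] := by
    have h1 := congrArg List.length (h [])
    rw [List.dropLast_nil, List.length_dropLast] at h1
    exact List.length_eq_zero_iff.1 (by omega)
  have key : ∀ v w, (∃ x, α w = α v ++ [x]) ↔ ∃ x, w = v ++ [x] := by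
    intro v w
    constructor
    · rintro ⟨x, hx⟩
      have hw : w ≠ [] := by
        rintro rfl
        rw [hnil] at hx
        simp at hx
      have h1 : α w.dropLast = α v := by rw [h, hx]; simp
      exact ⟨w.getLast hw, by rw [← α.injective h1, List.dropLast_append_getLast hw]⟩
    · rintro ⟨x, rfl⟩
      have hne : α (v ++ [x]) ≠ [] := by
        intro h0
        rw [← hnil] at h0
        simpa using α.injective h0
      refine ⟨(α (v ++ [x])).getLast hne, ?_⟩
      have h1 := h (v ++ [x])
      rw [List.dropLast_concat] at h1
      rw [h1, List.dropLast_append_getLast hne]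
  exact ⟨hnil, fun v w => or_congr (key v w) (key w v)⟩

/-- Constructor for automorphisms of `T_X` from a pair of mutually inverse maps. -/
def TreeAut.mk' {X : Type*} (f g : List X → List X) (hgf : ∀ v, g (f v) = v)
    (hfg : ∀ v, f (g v) = v) (h : ∀ v, f v.dropLast = (f v).dropLast) : TreeAut X :=
  ⟨⟨f, g, hgf, hfg⟩, mem_treeAut_of_dropLast _ h⟩

theorem TreeAut.mk'_smul {X : Type*} (f g : List X → List X) (hgf : ∀ v, g (f v) = v)
    (hfg : ∀ v, f (g v) = v) (h : ∀ v, f v.dropLast = (f v).dropLast) (v : List X) :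
    TreeAut.mk' f g hgf hfg h • v = f v := rfl

theorem TreeAut.ext_smul {X : Type*} {α β : TreeAut X} (h : ∀ v : List X, α • v = β • v) :
    α = β := Subtype.ext (Equiv.ext h)

/-! ## Stabilizers, rigid stabilizers, branch groups

Below, `G` is a group acting on the vertex set of `T_X`; this is used for subgroups of `Aut(T_X)`
with their natural action. -/

/-- The level `ℓ` stabilizer `St_G(ℓ)`, the intersection of the vertex stabilizers `St_G(v)` over
all vertices `v` of level `ℓ`. -/
def levelStabilizer (X : Type*) (G : Type*) [Group G] [MulAction G (List X)] (ℓ : ℕ) :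
    Subgroup G :=
  ⨅ (v : List X) (_ : v.length = ℓ), MulAction.stabilizer G v

/-- The rigid stabilizer `RiSt_G(v)`: the elements of `St_G(v)` that fix every vertex outside of
the subtree with vertex set `v X^*`. -/
def rigidStabilizer {X : Type*} (G : Type*) [Group G] [MulAction G (List X)] (v : List X) :
    Subgroup G :=
  MulAction.stabilizer G v ⊓ ⨅ (u : List X) (_ : ¬ v <+: u), MulAction.stabilizer G u

/-- The rigid level `ℓ` stabilizer `RiSt_G(ℓ)`, generated by all `RiSt_G(v)` with `v` of
level `ℓ`. -/
def rigidLevelStabilizer (X : Type*) (G : Type*) [Group G] [MulAction G (List X)] (ℓ : ℕ) :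
    Subgroup G :=
  ⨆ (v : List X) (_ : v.length = ℓ), rigidStabilizer G v

/-- `G` is a branch group: `RiSt_G(ℓ)` has finite index in `G` for every `ℓ`. -/
def IsBranchGroup (X : Type*) (G : Type*) [Group G] [MulAction G (List X)] : Prop :=
  ∀ ℓ : ℕ, (rigidLevelStabilizer X G ℓ).FiniteIndex

/-- `G` acts transitively on each level of the tree. -/
def IsLevelTransitive (X : Type*) (G : Type*) [Group G] [MulAction G (List X)] : Prop :=
  ∀ v w : List X, v.length = w.length → ∃ g : G, g • v = w

/-- An infinite group is just infinite if all its proper quotients are finite. -/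
def IsJustInfinite (G : Type*) [Group G] : Prop :=
  Infinite G ∧ ∀ N : Subgroup G, N.Normal → N ≠ ⊥ → Finite (G ⧸ N)

/-- `G` contains a non-abelian free group (equivalently, a free group of rank two). -/
def ContainsNonabelianFreeGroup (G : Type*) [Group G] : Prop :=
  ∃ f : FreeGroup (Fin 2) →* G, Function.Injective f

/-! ## The profinite topology of `Aut(T_X)` -/

theorem mem_levelStabilizer {X G : Type*} [Group G] [MulAction G (List X)] {ℓ : ℕ} {g : G} :
    g ∈ levelStabilizer X G ℓ ↔ ∀ v : List X, v.length = ℓ → g • v = v := by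
  simp [levelStabilizer, Subgroup.mem_iInf, MulAction.mem_stabilizer_iff]

theorem levelStabilizer_succ_le (X : Type*) (ℓ : ℕ) :
    levelStabilizer X (TreeAut X) (ℓ + 1) ≤ levelStabilizer X (TreeAut X) ℓ := by
  intro α h
  rw [mem_levelStabilizer] at h ⊢
  intro v hv
  rcases isEmpty_or_nonempty X with hX | ⟨⟨x⟩⟩
  · rw [Subsingleton.elim v [], treeAut_nil]
  · have h1 := h (v ++ [x]) (by simp [hv])
    have h2 := treeAut_dropLast α (v ++ [x])
    rwa [h1, List.dropLast_concat] at h2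

theorem levelStabilizer_antitone (X : Type*) : Antitone (levelStabilizer X (TreeAut X)) :=
  antitone_nat_of_succ_le (levelStabilizer_succ_le X)

/-- The subgroups `St_{Aut(T_X)}(ℓ)`, as a filter base of neighbourhoods of the identity. -/
@[reducible]
def treeFilterBasis (X : Type*) : GroupFilterBasis (TreeAut X) where
  sets := Set.range fun ℓ : ℕ => (levelStabilizer X (TreeAut X) ℓ : Set (TreeAut X))
  nonempty := ⟨_, 0, rfl⟩
  inter_sets := by
    rintro _ _ ⟨a, rfl⟩ ⟨b, rfl⟩
    exact ⟨_, ⟨max a b, rfl⟩, Set.subset_inter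
      (levelStabilizer_antitone X (le_max_left a b))
      (levelStabilizer_antitone X (le_max_right a b))⟩
  one' := by
    rintro _ ⟨a, rfl⟩
    exact one_mem _
  mul' := by
    rintro _ ⟨a, rfl⟩
    exact ⟨_, ⟨a, rfl⟩, Set.mul_subset_iff.2 fun x hx y hy => mul_mem hx hy⟩
  inv' := by
    rintro _ ⟨a, rfl⟩
    exact ⟨_, ⟨a, rfl⟩, fun x hx => inv_mem hx⟩
  conj' := by
    rintro α _ ⟨a, rfl⟩
    refine ⟨_, ⟨a, rfl⟩, fun x hx => ?_⟩
    simp only [SetLike.mem_coe, mem_levelStabilizer, Set.mem_preimage] at hx ⊢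
    intro v hv
    rw [mul_smul, mul_smul, hx _ (by rw [treeAut_length, hv]), smul_inv_smul]

instance treeAutTopologicalSpace (X : Type*) : TopologicalSpace (TreeAut X) :=
  (treeFilterBasis X).topology

instance treeAutIsTopologicalGroup (X : Type*) : IsTopologicalGroup (TreeAut X) :=
  (treeFilterBasis X).isTopologicalGroup

theorem treeAut_nhds_hasBasis {X : Type*} (α : TreeAut X) :
    (nhds α).HasBasis (fun _ : ℕ => True)
      fun ℓ => {β : TreeAut X | ∀ v : List X, v.length = ℓ → β • v = α • v} := by
  have h := (treeFilterBasis X).nhds_hasBasis α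
  refine ⟨fun t => ?_⟩
  rw [h.mem_iff]
  have key : ∀ ℓ : ℕ, (fun y => α * y) '' (levelStabilizer X (TreeAut X) ℓ : Set (TreeAut X)) =
      {β : TreeAut X | ∀ v : List X, v.length = ℓ → β • v = α • v} := by
    intro ℓ
    ext β
    simp only [Set.mem_image, SetLike.mem_coe, mem_levelStabilizer, Set.mem_ofPred_eq]
    constructor
    · rintro ⟨y, hy, rfl⟩ v hv
      rw [mul_smul, hy v hv]
    · intro hb
      exact ⟨α⁻¹ * β, fun v hv => by rw [mul_smul, hb v hv, inv_smul_smul], by simp⟩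
  constructor
  · rintro ⟨_, ⟨ℓ, rfl⟩, hs⟩
    exact ⟨ℓ, trivial, by rw [← key]; exact hs⟩
  · rintro ⟨ℓ, -, hs⟩
    exact ⟨_, ⟨ℓ, rfl⟩, by rw [← key] at hs; exact hs⟩

instance treeAutTotallyDisconnectedSpace (X : Type*) : TotallyDisconnectedSpace (TreeAut X) := by
  have hopen : ∀ (v : List X) (s : Set (List X)), IsOpen {γ : TreeAut X | γ • v ∈ s} := by
    intro v s
    rw [isOpen_iff_mem_nhds]
    intro β hb
    refine ((treeAut_nhds_hasBasis β).mem_iff).2 ⟨v.length, trivial, fun γ hγ => ?_⟩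
    have h1 : γ • v = β • v := hγ v rfl
    rw [Set.mem_ofPred_eq, h1]
    exact hb
  have : TotallySeparatedSpace (TreeAut X) := by
    rw [totallySeparatedSpace_iff_exists_isClopen]
    intro α β hne
    obtain ⟨v, hv⟩ : ∃ v : List X, α • v ≠ β • v := by
      by_contra! hc
      exact hne (TreeAut.ext_smul hc)
    refine ⟨{γ | γ • v ∈ ({α • v} : Set (List X))}, ⟨⟨?_⟩, hopen v _⟩, rfl, fun h => hv ?_⟩
    · exact hopen v ({α • v}ᶜ)
    · exact (Set.mem_singleton_iff.1 h).symm
  infer_instance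

instance treeAutCompactSpace (X : Type*) [Finite X] : CompactSpace (TreeAut X) := by
  refine ⟨isCompact_iff_ultrafilter_le_nhds.2 fun F _ => ?_⟩
  have hlim : ∀ s : TreeAut X → TreeAut X, ∀ v : List X,
      ∃ w : List X, ∀ᶠ α in (F : Filter (TreeAut X)), s α • v = w := by
    intro s v
    have hfin : {w : List X | w.length = v.length}.Finite := List.finite_length_eq X v.length
    have h1 : (⋃ w ∈ {w : List X | w.length = v.length}, {α | s α • v = w}) ∈ F := by
      refine Filter.mem_of_superset Filter.univ_mem fun α _ => ?_
      simp only [Set.mem_iUnion]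
      exact ⟨s α • v, treeAut_length _ _, rfl⟩
    obtain ⟨w, -, hw⟩ := (Ultrafilter.finite_biUnion_mem_iff hfin).1 h1
    exact ⟨w, hw⟩
  choose f hf using hlim id
  choose g hg using hlim fun α => α⁻¹
  have hgf : ∀ v, g (f v) = v := by
    intro v
    obtain ⟨α, h1, h2⟩ := ((hf v).and (hg (f v))).exists
    rw [← h2, ← h1]
    exact inv_smul_smul α v
  have hfg : ∀ v, f (g v) = v := by
    intro v
    obtain ⟨α, h1, h2⟩ := ((hg v).and (hf (g v))).exists
    rw [← h2, ← h1]
    exact smul_inv_smul α v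
  have hd : ∀ v, f v.dropLast = (f v).dropLast := by
    intro v
    obtain ⟨α, h1, h2⟩ := ((hf v).and (hf v.dropLast)).exists
    rw [← h2, ← h1]
    exact treeAut_dropLast α v
  refine ⟨TreeAut.mk' f g hgf hfg hd, Set.mem_univ _, ?_⟩
  rw [(treeAut_nhds_hasBasis _).ge_iff]
  intro ℓ _
  have hall := ((List.finite_length_eq X ℓ).eventually_all (l := (F : Filter (TreeAut X)))
    (p := fun v α => α • v = f v)).2 fun v _ => hf v
  exact hall

/-! ## Tree completion, profinite completion, congruence subgroup property -/

instance closureCompactSpace {X : Type*} [Finite X] (G : Subgroup (TreeAut X)) :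
    CompactSpace ↥G.topologicalClosure :=
  isCompact_iff_compactSpace.1 G.isClosed_topologicalClosure.isCompact

/-- The tree completion of `G ≤ Aut(T_X)`: the closure of `G` in `Aut(T_X)`, as a profinite
group. -/
def treeCompletion {X : Type*} [Finite X] (G : Subgroup (TreeAut X)) : ProfiniteGrp :=
  ProfiniteGrp.of ↥G.topologicalClosure

/-- The inclusion of `G ≤ Aut(T_X)` into its closure. -/
def toTreeCompletion {X : Type*} [Finite X] (G : Subgroup (TreeAut X)) :
    GrpCat.of ↥G ⟶ GrpCat.of (treeCompletion G) :=
  GrpCat.ofHom (Subgroup.inclusion G.le_topologicalClosure :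
    ↥G →* ↥G.topologicalClosure)

/-- The profinite completion of a group, the inverse limit of its finite quotients. -/
abbrev profCompletion (G : Type*) [Group G] : ProfiniteGrp :=
  ProfiniteGrp.profiniteCompletion.obj (GrpCat.of G)

/-- The homomorphism between profinite completions that is induced by a group homomorphism. -/
abbrev profCompletionMap.{u} {G H : Type u} [Group G] [Group H] (f : G →* H) :
    profCompletion G ⟶ profCompletion H :=
  ProfiniteGrp.profiniteCompletion.map (GrpCat.ofHom f)

/-- The canonical homomorphism from the profinite completion of `G ≤ Aut(T_X)` to the tree
completion of `G`, given by the universal property of the profinite completion. -/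
def treeRes {X : Type*} [Finite X] (G : Subgroup (TreeAut X)) :
    profCompletion ↥G ⟶ treeCompletion G :=
  ProfiniteGrp.ProfiniteCompletion.lift (toTreeCompletion G)

/-- The congruence subgroup property: the canonical homomorphism from the profinite completion to
the tree completion is an isomorphism (of profinite groups). -/
def HasCSP {X : Type*} [Finite X] (G : Subgroup (TreeAut X)) : Prop :=
  IsIso (treeRes G)

/-! ## The `Ω`-construction -/

/-- The space of infinite sequences over `X \ {o}`. The sequence `(ω₁, ω₂, …)` is indexed
from `0` here, i.e. `ω₁` is `ω 0`. -/
abbrev BoundarySeq (X : Type*) (o : X) : Type _ := ℕ → {x : X // x ≠ o}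

/-- The left shift `(ω₁, ω₂, …) ↦ (ω₂, ω₃, …)`. -/
def BoundarySeq.shift {X : Type*} {o : X} (ω : BoundarySeq X o) : BoundarySeq X o :=
  fun k => ω (k + 1)

/-- The action on words of the automorphism `α̃^ω` with trivial action on the first level, whose
state at `o` is `α̃^{L(ω)}`, whose state at `ω₁` is `α` and whose other states are trivial. -/
def tildeFun {X : Type*} [DecidableEq X] {o : X} (α : TreeAut X) :
    BoundarySeq X o → List X → List X
  | _, [] => []
  | ω, x :: w =>
    if x = o then x :: tildeFun α ω.shift w
    else if x = (ω 0 : X) then x :: (α • w)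
    else x :: w

theorem tildeFun_one {X : Type*} [DecidableEq X] {o : X} (v : List X) :
    ∀ ω : BoundarySeq X o, tildeFun 1 ω v = v := by
  induction v with
  | nil => intro ω; rfl
  | cons x w ih =>
    intro ω
    simp [tildeFun, ih]

theorem tildeFun_mul {X : Type*} [DecidableEq X] {o : X} (α β : TreeAut X) (v : List X) :
    ∀ ω : BoundarySeq X o, tildeFun (α * β) ω v = tildeFun α ω (tildeFun β ω v) := by
  induction v with
  | nil => intro ω; rfl
  | cons x w ih =>
    intro ω
    by_cases h1 : x = o
    · simp [tildeFun, ih, h1]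
    · by_cases h2 : x = (ω 0 : X)
      · simp [tildeFun, h2, (ω 0).2, mul_smul]
      · simp [tildeFun, h1, h2]

theorem tildeFun_length {X : Type*} [DecidableEq X] {o : X} (α : TreeAut X) (v : List X) :
    ∀ ω : BoundarySeq X o, (tildeFun α ω v).length = v.length := by
  induction v with
  | nil => intro ω; rfl
  | cons x w ih =>
    intro ω
    simp only [tildeFun]
    split_ifs <;> simp [ih, treeAut_length]

theorem tildeFun_dropLast {X : Type*} [DecidableEq X] {o : X} (α : TreeAut X) (v : List X) :
    ∀ ω : BoundarySeq X o, tildeFun α ω v.dropLast = (tildeFun α ω v).dropLast := by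
  induction v with
  | nil => intro ω; rfl
  | cons x w ih =>
    intro ω
    by_cases hw : w = []
    · subst hw
      simp only [tildeFun, List.dropLast_singleton]
      split_ifs <;> simp [treeAut_nil]
    · have h1 : α • w ≠ [] := fun h => hw (List.length_eq_zero_iff.1
        (by rw [← treeAut_length α, h]; rfl))
      have h2 : tildeFun α ω.shift w ≠ [] := fun h => hw (List.length_eq_zero_iff.1
        (by rw [← tildeFun_length α w ω.shift, h]; rfl))
      rw [List.dropLast_cons_of_ne_nil hw]
      simp only [tildeFun]
      split_ifs
      · rw [List.dropLast_cons_of_ne_nil h2, ih]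
      · rw [List.dropLast_cons_of_ne_nil h1, treeAut_dropLast]
      · rw [List.dropLast_cons_of_ne_nil hw]

/-- The homomorphism `Aut(T_X) → Aut(T_X)`, `α ↦ α̃^ω`. -/
def tildeHom {X : Type*} [DecidableEq X] {o : X} (ω : BoundarySeq X o) :
    TreeAut X →* TreeAut X where
  toFun α := TreeAut.mk' (tildeFun α ω) (tildeFun α⁻¹ ω)
    (fun v => by rw [← tildeFun_mul, inv_mul_cancel, tildeFun_one])
    (fun v => by rw [← tildeFun_mul, mul_inv_cancel, tildeFun_one])
    (fun v => tildeFun_dropLast α v ω)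
  map_one' := TreeAut.ext_smul fun v => tildeFun_one v ω
  map_mul' α β := TreeAut.ext_smul fun v => tildeFun_mul α β v ω

/-- `Γ_G^Ω`: the subgroup of `Aut(T_X)` generated by the groups `Γ_G^ω = ⟨G, G̃^ω⟩`
with `ω ∈ Ω`. -/
def omegaGroup {X : Type*} [DecidableEq X] {o : X} (G : Subgroup (TreeAut X))
    (Ω : Set (BoundarySeq X o)) : Subgroup (TreeAut X) :=
  ⨆ ω ∈ Ω, G ⊔ G.map (tildeHom ω)

theorem omegaGroup_mono {X : Type*} [DecidableEq X] {o : X} (G : Subgroup (TreeAut X))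
    {Ω₁ Ω₂ : Set (BoundarySeq X o)} (h : Ω₁ ⊆ Ω₂) : omegaGroup G Ω₁ ≤ omegaGroup G Ω₂ :=
  biSup_mono h

/-! ## Special affine groups acting on `T_{p,n}` -/

/-- `SAff_n(R)`: the affine transformations of `R^n` whose linear part has determinant `1`. -/
def SAff (n : ℕ) (R : Type*) [CommRing R] : Subgroup ((Fin n → R) ≃ᵃ[R] (Fin n → R)) :=
  ((LinearEquiv.det : ((Fin n → R) ≃ₗ[R] (Fin n → R)) →* Rˣ).comp AffineEquiv.linearHom).ker

/-- The alphabet `{0, …, p-1}^n`. -/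
abbrev Alphabet (p n : ℕ) : Type := Fin n → Fin p

/-- The integral vector `x₀ + p x₁ + ⋯ + p^{ℓ-1} x_{ℓ-1}` that represents the word
`x₀ x₁ ⋯ x_{ℓ-1}` in `(ℤ/p^ℓ)^n`. -/
def wordValue {p n : ℕ} : List (Alphabet p n) → (Fin n → ℤ)
  | [] => 0
  | x :: w => (fun i => ((x i : ℕ) : ℤ)) + (p : ℤ) • wordValue w

/-- The word of length `ℓ` consisting of the first `ℓ` digits of the base `p` expansion of an
integral vector; it represents the vector modulo `p^ℓ`. -/
def digitWord (p : ℕ) [NeZero p] {n : ℕ} : ℕ → (Fin n → ℤ) → List (Alphabet p n)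
  | 0, _ => []
  | ℓ + 1, u =>
    (fun i => ⟨(u i % (p : ℤ)).toNat, by
      have hp : (0 : ℤ) < p := by exact_mod_cast Nat.pos_of_ne_zero (NeZero.ne p)
      have h1 := Int.emod_nonneg (u i) hp.ne'
      have h2 := Int.emod_lt_of_pos (u i) hp
      omega⟩) :: digitWord p ℓ (fun i => u i / (p : ℤ))

theorem digitWord_length (p : ℕ) [NeZero p] {n : ℕ} (ℓ : ℕ) :
    ∀ u : Fin n → ℤ, (digitWord p ℓ u).length = ℓ := by
  induction ℓ with
  | zero => intro u; rfl
  | succ ℓ ih => intro u; simp [digitWord, ih]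

theorem digitWord_dropLast (p : ℕ) [NeZero p] {n : ℕ} (ℓ : ℕ) :
    ∀ u : Fin n → ℤ, (digitWord p ℓ u).dropLast = digitWord p (ℓ - 1) u := by
  induction ℓ with
  | zero => intro u; rfl
  | succ ℓ ih =>
    intro u
    cases ℓ with
    | zero => rfl
    | succ ℓ =>
      have hne : digitWord p (ℓ + 1) (fun i => u i / (p : ℤ)) ≠ [] := by
        simp [digitWord]
      rw [digitWord, List.dropLast_cons_of_ne_nil hne, ih]
      rfl

/-- `digitWord p ℓ u` represents `u` modulo `p^ℓ`. -/
theorem wordValue_digitWord (p : ℕ) [NeZero p] {n : ℕ} (ℓ : ℕ) :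
    ∀ u : Fin n → ℤ, ∃ z : Fin n → ℤ, u = wordValue (digitWord p ℓ u) + ((p : ℤ) ^ ℓ) • z := by
  induction ℓ with
  | zero => intro u; exact ⟨u, by simp [digitWord, wordValue]⟩
  | succ ℓ ih =>
    intro u
    obtain ⟨z, hz⟩ := ih fun i => u i / (p : ℤ)
    refine ⟨z, funext fun i => ?_⟩
    have hp : (p : ℤ) ≠ 0 := by exact_mod_cast NeZero.ne p
    have h1 := Int.emod_nonneg (u i) hp
    have h2 := Int.mul_ediv_add_emod (u i) (p : ℤ)
    have h3 := congrFun hz i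
    simp only [Pi.add_apply, Pi.smul_apply, smul_eq_mul] at h3
    simp only [digitWord, wordValue, Pi.add_apply, Pi.smul_apply, smul_eq_mul]
    rw [Int.toNat_of_nonneg h1]
    rw [h3] at h2
    rw [pow_succ]
    linear_combination -h2

/-- The word `digitWord p ℓ u` only depends on `u` modulo `p^ℓ`. -/
theorem digitWord_add (p : ℕ) [NeZero p] {n : ℕ} (ℓ : ℕ) :
    ∀ u z : Fin n → ℤ, digitWord p ℓ (u + ((p : ℤ) ^ ℓ) • z) = digitWord p ℓ u := by
  induction ℓ with
  | zero => intro u z; rfl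
  | succ ℓ ih =>
    intro u z
    have hp : (p : ℤ) ≠ 0 := by exact_mod_cast NeZero.ne p
    have h1 : ∀ i, (u + ((p : ℤ) ^ (ℓ + 1)) • z) i = u i + (p : ℤ) * ((p : ℤ) ^ ℓ * z i) := by
      intro i
      simp only [Pi.add_apply, Pi.smul_apply, smul_eq_mul]
      ring
    have h2 : (fun i => (u + ((p : ℤ) ^ (ℓ + 1)) • z) i / (p : ℤ)) =
        (fun i => u i / (p : ℤ)) + ((p : ℤ) ^ ℓ) • z := by
      funext i
      rw [h1, Int.add_mul_ediv_left _ _ hp]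
      rfl
    simp only [digitWord]
    rw [h2, ih]
    congr 1
    funext i
    rw [Fin.mk.injEq, h1, Int.add_mul_emod_self_left]

theorem digitWord_wordValue {p : ℕ} [NeZero p] {n : ℕ} (w : List (Alphabet p n)) :
    digitWord p w.length (wordValue w) = w := by
  induction w with
  | nil => rfl
  | cons x w ih =>
    have hp : (p : ℤ) ≠ 0 := by exact_mod_cast NeZero.ne p
    have hlt : ∀ i, (((x i : ℕ) : ℤ)) < p := fun i => by exact_mod_cast (x i).2
    have h1 : (fun i => wordValue (x :: w) i / (p : ℤ)) = wordValue w := by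
      funext i
      simp only [wordValue, Pi.add_apply, Pi.smul_apply, smul_eq_mul]
      rw [Int.add_mul_ediv_left _ _ hp, Int.ediv_eq_zero_of_lt (by positivity) (hlt i), zero_add]
    rw [List.length_cons, digitWord, h1, ih]
    congr 1
    funext i
    apply Fin.ext
    simp only [wordValue, Pi.add_apply, Pi.smul_apply, smul_eq_mul]
    rw [Int.add_mul_emod_self_left, Int.emod_eq_of_lt (by positivity) (hlt i), Int.toNat_natCast]

/-- The action of an integral affine transformation `g` on words: a word of length `ℓ`
representing `u ∈ (ℤ/p^ℓ)^n` is mapped to the word of length `ℓ` representing `g(u)`. -/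
def affineAct {p : ℕ} [NeZero p] {n : ℕ} (g : (Fin n → ℤ) ≃ᵃ[ℤ] (Fin n → ℤ))
    (w : List (Alphabet p n)) : List (Alphabet p n) :=
  digitWord p w.length (g (wordValue w))

theorem affineAct_digitWord (p : ℕ) [NeZero p] {n : ℕ} (g : (Fin n → ℤ) ≃ᵃ[ℤ] (Fin n → ℤ))
    (ℓ : ℕ) (u : Fin n → ℤ) : affineAct g (digitWord p ℓ u) = digitWord p ℓ (g u) := by
  obtain ⟨z, hz⟩ := wordValue_digitWord p ℓ u
  have h : g u = g (wordValue (digitWord p ℓ u)) + ((p : ℤ) ^ ℓ) • g.linear z := by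
    conv_lhs => rw [hz, add_comm]
    rw [← vadd_eq_add, AffineEquiv.map_vadd, map_smul, vadd_eq_add, add_comm]
  rw [affineAct, digitWord_length, h, digitWord_add]

theorem affineAct_one {p : ℕ} [NeZero p] {n : ℕ} (w : List (Alphabet p n)) :
    affineAct 1 w = w := digitWord_wordValue w

theorem affineAct_mul {p : ℕ} [NeZero p] {n : ℕ} (g h : (Fin n → ℤ) ≃ᵃ[ℤ] (Fin n → ℤ))
    (w : List (Alphabet p n)) : affineAct (g * h) w = affineAct g (affineAct h w) := by
  conv_rhs => rw [affineAct.eq_def h, affineAct_digitWord]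
  rfl

theorem affineAct_dropLast {p : ℕ} [NeZero p] {n : ℕ} (g : (Fin n → ℤ) ≃ᵃ[ℤ] (Fin n → ℤ))
    (w : List (Alphabet p n)) : affineAct g w.dropLast = (affineAct g w).dropLast := by
  conv_lhs => rw [← digitWord_wordValue w, digitWord_dropLast, affineAct_digitWord]
  rw [affineAct, digitWord_dropLast]

/-- The action of `SAff_n(ℤ)` on the tree `T_{p,n}`. -/
def affineHom (p n : ℕ) [NeZero p] : ↥(SAff n ℤ) →* TreeAut (Alphabet p n) where
  toFun g := TreeAut.mk' (affineAct g.1) (affineAct g⁻¹.1)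
    (fun v => by rw [← affineAct_mul, ← Subgroup.coe_mul, inv_mul_cancel]; exact affineAct_one v)
    (fun v => by rw [← affineAct_mul, ← Subgroup.coe_mul, mul_inv_cancel]; exact affineAct_one v)
    (affineAct_dropLast g.1)
  map_one' := TreeAut.ext_smul fun v => affineAct_one v
  map_mul' g h := TreeAut.ext_smul fun v => affineAct_mul g.1 h.1 v

/-- The space `𝒮_{p,n}` of infinite sequences over `{0, …, p-1}^n \ {0}`. -/
abbrev SeqSpace (p n : ℕ) [NeZero p] : Type := BoundarySeq (Alphabet p n) 0

/-- The group `Γ_{p,n}^Ω ≤ Aut(T_{p,n})`. -/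
def affineOmegaGroup {p n : ℕ} [NeZero p] (Ω : Set (SeqSpace p n)) :
    Subgroup (TreeAut (Alphabet p n)) :=
  omegaGroup (affineHom p n).range Ω

/-- The inclusion of `Γ_{p,n}^{Ω₁}` into `Γ_{p,n}^{Ω₂}` for `Ω₁ ⊆ Ω₂`. -/
def affineOmegaInclusion {p n : ℕ} [NeZero p] {Ω₁ Ω₂ : Set (SeqSpace p n)} (h : Ω₁ ⊆ Ω₂) :
    ↥(affineOmegaGroup Ω₁) →* ↥(affineOmegaGroup Ω₂) :=
  Subgroup.inclusion (omegaGroup_mono _ h)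

end

/-! Write Γ^Ω for `omegaGroup G Ω`, L for the shift, RiSt and St for rigid and level stabilizers.
Little arithmetic enters: for `n ≥ 3` the image `G` of SAff_n(ℤ) is perfect (transvections generate
SL_n(ℤ) and are commutators), its sections at letters stay in `G`, it is transitive on levels, and
for every letter `x ≠ 0` some element fixes `x` and moves `0`. This is `IsBranchSeed`.

From it, a commutator trick (`graftLetter_head_mem`) shows that Γ^Ω contains `G` acting on the
single subtree at `ω 0`. It follows that Γ^Ω contains Γ^{LΩ} acting on any one first-level subtree
(`graftLetter_mem`), while all its first-level sections lie in Γ^{LΩ}. So RiSt(v) is exactly a copy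
of Γ^{L^{|v|}Ω}; it is perfect and level-transitive below `v`, and St(ℓ) is generated by the RiSt(v)
of level ℓ. This is `IsPerfectBranch`. The action on each finite level does not depend on Ω
(`exists_agree`), hence neither does the closure.

A double commutator shows that a normal subgroup moving a vertex `u` contains RiSt(u). Therefore
each normal subgroup is comparable with each St(ℓ), and a nontrivial one contains some St(ℓ). This
makes Γ^Ω just infinite and gives the congruence subgroup property; with equal closures it also
identifies the profinite completions. The free subgroup comes from ping-pong in SAff_n(ℤ).

For the conjugacy statement, an isomorphism preserves St(ℓ), since the preimage of St(ℓ) is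
comparable with St(ℓ) and of the same index. It then maps each RiSt(v) into some RiSt(w)
(`exists_rigidStabilizer_le`), and `v ↦ w` is the conjugating tree automorphism (`exists_conj_eq`).
-/

open scoped commutatorElement

/-! ## Generation of `SL_n(ℤ)` by transvections and perfectness of `SAff_n(ℤ)` -/

namespace Matrix.SpecialLinearGroup

variable {ι : Type*} [DecidableEq ι] [Fintype ι]

theorem transvection_mul_apply {R : Type*} [CommRing R] {k l : ι} (h : k ≠ l) (c : R)
    (g : SpecialLinearGroup ι R) (a b : ι) :
    (transvection h c * g) a b = if a = k then g k b + c * g l b else g a b := by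
  change (Matrix.transvection k l c * (g : Matrix ι ι R)) a b = _
  split_ifs with ha
  · subst ha
    exact Matrix.transvection_mul_apply_same a l b c _
  · exact Matrix.transvection_mul_apply_of_ne k l a b ha c _

/-- The columns of `g` with index in `S` are standard basis vectors. -/
def FixesColumns {R : Type*} [CommRing R] (S : Finset ι) (g : SpecialLinearGroup ι R) : Prop :=
  ∀ j ∈ S, ∀ k, g k j = (1 : Matrix ι ι R) k j

/-- Row `l ∉ S` vanishes in the columns of `S`, so adding a multiple of it does not disturb them. -/
theorem FixesColumns.transvection_mul {R : Type*} [CommRing R] {S : Finset ι}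
    {g : SpecialLinearGroup ι R} (hg : FixesColumns S g) {k l : ι} (h : k ≠ l) (hl : l ∉ S)
    (c : R) : FixesColumns S (transvection h c * g) := by
  intro j hj a
  rw [transvection_mul_apply]
  split_ifs with ha
  · subst ha
    rw [hg j hj, hg j hj, Matrix.one_apply_ne (ne_of_mem_of_not_mem hj hl).symm, mul_zero, add_zero]
  · exact hg j hj a

/-- Row `i` of `g⁻¹` vanishes on `S`, because the columns of `g` in `S` are standard. The entry `(i,
i)` of `g⁻¹ g = 1` thus involves only rows outside `S`. -/
theorem FixesColumns.exists_sum_eq_one {R : Type*} [CommRing R] {S : Finset ι}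
    {g : SpecialLinearGroup ι R} (hg : FixesColumns S g) {i : ι} (hi : i ∉ S) :
    ∃ r : ι → R, ∑ k ∈ Sᶜ, r k * g k i = 1 := by
  have hmul : ∀ a b, ∑ m, g⁻¹ a m * g m b = (1 : Matrix ι ι R) a b := by
    intro a b
    have h := congrArg (fun A : SpecialLinearGroup ι R => A a b) (inv_mul_cancel g)
    simpa only [coe_mul, coe_one, Matrix.mul_apply] using h
  refine ⟨fun k => g⁻¹ i k, ?_⟩
  have hzero : ∀ k ∈ S, g⁻¹ i k = 0 := by
    intro k hk
    have h := hmul i k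
    rw [Matrix.one_apply_ne (ne_of_mem_of_not_mem hk hi).symm, Finset.sum_eq_single k] at h
    · rwa [hg k hk, Matrix.one_apply_eq, mul_one] at h
    · intro m _ hm
      rw [hg k hk, Matrix.one_apply_ne hm, mul_zero]
    · simp
  have h := hmul i i
  rw [Matrix.one_apply_eq, ← Finset.sum_compl_add_sum S, Finset.sum_eq_zero (s := S), add_zero] at h
  · exact h
  · intro k hk
    rw [hzero k hk, zero_mul]

/-! ### Euclidean row reduction of integral matrices -/

section Int

variable {E : Subgroup (SpecialLinearGroup ι ℤ)}
  (hE : ∀ (k l : ι) (h : k ≠ l) (c : ℤ), transvection h c ∈ E)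

include hE

/-- Euclid's algorithm on the part of column `i` outside `S`: while two entries are nonzero, the sum
of absolute values can be lowered; a single remaining entry is a unit by `exists_sum_eq_one`. -/
theorem FixesColumns.exists_unit_entry {S : Finset ι} {i : ι} (hi : i ∉ S) (m : ℕ) :
    ∀ g : SpecialLinearGroup ι ℤ, FixesColumns S g → ∑ k ∈ Sᶜ, (g k i).natAbs = m →
      ∃ e ∈ E, FixesColumns S (e * g) ∧
        ∃ l ∉ S, (e * g) l i * (e * g) l i = 1 := by
  induction m using Nat.strong_induction_on with
  | _ m ih =>
    intro g hg hm
    by_cases hex : ∃ k l, k ∉ S ∧ l ∉ S ∧ k ≠ l ∧ g k i ≠ 0 ∧ g l i ≠ 0 ∧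
        (g l i).natAbs ≤ (g k i).natAbs
    · obtain ⟨k, l, hk, hl, hkl, hk0, hl0, hle⟩ := hex
      -- One addition or subtraction, chosen by the signs, already shrinks the larger entry; no
      -- division with remainder is needed.
      obtain ⟨c, hc⟩ : ∃ c : ℤ, (g k i + c * g l i).natAbs < (g k i).natAbs := by
        by_cases hs : (0 < g k i ↔ 0 < g l i)
        · exact ⟨-1, by omega⟩
        · exact ⟨1, by omega⟩
      have hlt : ∑ a ∈ Sᶜ, ((transvection hkl c * g) a i).natAbs < m := by
        rw [← hm]
        refine Finset.sum_lt_sum (fun a _ => ?_) ⟨k, by simpa using hk, ?_⟩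
        · rw [transvection_mul_apply]
          split_ifs with ha
          · subst ha; exact hc.le
          · exact le_rfl
        · rw [transvection_mul_apply, if_pos rfl]
          exact hc
      obtain ⟨e, he, h1, h2⟩ := ih _ hlt _ (hg.transvection_mul hkl hl c) rfl
      exact ⟨e * transvection hkl c, mul_mem he (hE _ _ _ _), by rwa [mul_assoc],
        by rwa [mul_assoc]⟩
    · refine ⟨1, one_mem _, by rwa [one_mul], ?_⟩
      rw [one_mul]
      obtain ⟨r, hr⟩ := hg.exists_sum_eq_one hi
      obtain ⟨l, hl, hl0⟩ : ∃ l ∈ Sᶜ, r l * g l i ≠ 0 :=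
        Finset.exists_ne_zero_of_sum_ne_zero (by rw [hr]; exact one_ne_zero)
      rw [Finset.mem_compl] at hl
      refine ⟨l, hl, ?_⟩
      rw [Finset.sum_eq_single l] at hr
      · rcases Int.isUnit_iff.1 (IsUnit.of_mul_eq_one_right _ hr) with h | h <;> rw [h] <;> norm_num
      · intro k hk hkl
        rw [Finset.mem_compl] at hk
        by_contra h0
        rcases le_total (g l i).natAbs (g k i).natAbs with h | h
        · exact hex ⟨k, l, hk, hl, hkl, right_ne_zero_of_mul h0, right_ne_zero_of_mul hl0, h⟩
        · exact hex ⟨l, k, hl, hk, hkl.symm, right_ne_zero_of_mul hl0, right_ne_zero_of_mul h0, h⟩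
      · intro h
        exact absurd (Finset.mem_compl.2 hl) h

theorem FixesColumns.exists_diag_eq_one {S : Finset ι} {i : ι} (hi : i ∉ S)
    {g : SpecialLinearGroup ι ℤ} (hg : FixesColumns S g) :
    ∃ e ∈ E, FixesColumns S (e * g) ∧ (e * g) i i = 1 := by
  have off : ∀ (g : SpecialLinearGroup ι ℤ) (l : ι), FixesColumns S g → l ∉ S → l ≠ i →
      g l i * g l i = 1 → ∃ e ∈ E, FixesColumns S (e * g) ∧ (e * g) i i = 1 := by
    intro g l hg hl hli h
    -- The entry `g l i` is its own inverse, so the diagonal entry becomes `g i i + (1 - g i i) =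
    -- 1`.
    refine ⟨transvection hli.symm (g l i * (1 - g i i)), hE _ _ _ _, hg.transvection_mul _ hl _, ?_⟩
    rw [transvection_mul_apply, if_pos rfl]
    linear_combination (1 - g i i) * h
  obtain ⟨e, he, h1, l, hl, h2⟩ := FixesColumns.exists_unit_entry hE hi _ g hg rfl
  by_cases hli : l = i
  · subst hli
    rcases mul_self_eq_one_iff.1 h2 with h3 | h3
    · exact ⟨e, he, h1, h3⟩
    by_cases hk : ∃ k, k ∉ S ∧ k ≠ l
    · obtain ⟨k, hk, hkl⟩ := hk
      -- As the diagonal entry is `-1`, this multiplier makes the entry `(k, l)` equal to `1`, which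
      -- is the off-diagonal case.
      obtain ⟨e', he', h4, h5⟩ := off (transvection hkl ((e * g) k l - 1) * (e * g)) k
        (h1.transvection_mul _ hl _) hk hkl (by
          rw [transvection_mul_apply, if_pos rfl, h3]
          ring)
      refine ⟨e' * (transvection hkl ((e * g) k l - 1) * e),
        mul_mem he' (mul_mem (hE _ _ _ _) he), ?_, ?_⟩
      · simpa only [mul_assoc] using h4
      · simpa only [mul_assoc] using h5
    · push Not at hk
      refine ⟨e, he, h1, ?_⟩
      -- Every column except `l` is standard, so the determinant `1` is the diagonal entry itself.
      have h4 : ((e * g : SpecialLinearGroup ι ℤ) : Matrix ι ι ℤ) =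
          (1 : Matrix ι ι ℤ).updateCol l (fun a => (e * g) a l) := by
        ext a b
        by_cases hb : b = l
        · subst hb; simp
        · rw [Matrix.updateCol_ne hb]
          exact h1 b (by by_contra hS; exact hb (hk b hS)) a
      have h5 := det_coe (e * g)
      rw [h4, ← Matrix.cramer_apply, Matrix.cramer_one] at h5
      exact h5
  · obtain ⟨e', he', h4, h5⟩ := off _ l h1 hl hli h2
    exact ⟨e' * e, mul_mem he' he, by rwa [mul_assoc], by rwa [mul_assoc]⟩

theorem FixesColumns.exists_insert {S : Finset ι} {i : ι} (hi : i ∉ S)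
    {g : SpecialLinearGroup ι ℤ} (hg : FixesColumns S g) :
    ∃ e ∈ E, FixesColumns (insert i S) (e * g) := by
  have clear : ∀ T : Finset ι, i ∉ T → ∃ e ∈ E, FixesColumns S (e * g) ∧ (e * g) i i = 1 ∧
      ∀ k ∈ T, (e * g) k i = 0 := by
    intro T
    induction T using Finset.induction_on with
    | empty =>
      intro _
      obtain ⟨e, he, h1, h2⟩ := hg.exists_diag_eq_one hE hi
      exact ⟨e, he, h1, h2, by simp⟩
    | insert k T hk ih =>
      intro hT
      rw [Finset.mem_insert, not_or] at hT
      obtain ⟨e, he, h1, h2, h3⟩ := ih hT.2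
      have hki : k ≠ i := Ne.symm hT.1
      refine ⟨transvection hki (-(e * g) k i) * e, mul_mem (hE _ _ _ _) he, ?_, ?_, ?_⟩
      · rw [mul_assoc]
        exact h1.transvection_mul _ hi _
      · rw [mul_assoc, transvection_mul_apply, if_neg hT.1, h2]
      · intro a ha
        rw [mul_assoc, transvection_mul_apply]
        split_ifs with hak
        · rw [h2]; ring
        · exact h3 a ((Finset.mem_insert.1 ha).resolve_left hak)
  obtain ⟨e, he, h1, h2, h3⟩ := clear (Finset.univ.erase i) (by simp)
  refine ⟨e, he, fun j hj a => ?_⟩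
  rcases Finset.mem_insert.1 hj with rfl | hj
  · by_cases ha : a = j
    · subst ha; rw [h2, Matrix.one_apply_eq]
    · rw [h3 a (by simpa using ha), Matrix.one_apply_ne ha]
  · exact h1 j hj a

/-- A subgroup of `SL_n(ℤ)` that contains all transvections is everything. -/
theorem eq_top_of_transvection_mem : E = ⊤ := by
  have key : ∀ (m : ℕ) (S : Finset ι) (g : SpecialLinearGroup ι ℤ), Sᶜ.card = m →
      FixesColumns S g → g ∈ E := by
    intro m
    induction m with
    | zero =>
      intro S g hm hg
      rw [Finset.card_eq_zero, Finset.compl_eq_empty_iff] at hm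
      subst hm
      have : g = 1 := by
        ext a b
        exact hg b (Finset.mem_univ b) a
      rw [this]
      exact one_mem _
    | succ m ih =>
      intro S g hm hg
      obtain ⟨i, hi⟩ : Sᶜ.Nonempty := by rw [← Finset.card_pos]; omega
      rw [Finset.mem_compl] at hi
      obtain ⟨e, he, h⟩ := hg.exists_insert hE hi
      have h2 : (insert i S)ᶜ.card = m := by
        rw [Finset.card_compl] at hm ⊢
        rw [Finset.card_insert_of_notMem hi]
        omega
      exact (Subgroup.mul_mem_cancel_left _ he).1 (ih _ _ h2 h)
  exact eq_top_iff.2 fun g _ => key _ ∅ g rfl (by simp [FixesColumns])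

end Int

theorem commutatorElement_transvection {R : Type*} [CommRing R] {i j k : ι} (hik : i ≠ k)
    (hkj : k ≠ j) (hij : i ≠ j) (a b : R) :
    ⁅transvection hik a, transvection hkj b⁆ = transvection hij (a * b) := by
  rw [commutatorElement_def, mul_inv_eq_iff_eq_mul, mul_inv_eq_iff_eq_mul]
  refine Subtype.ext ?_
  change Matrix.transvection i k a * Matrix.transvection k j b =
    Matrix.transvection i j (a * b) * Matrix.transvection k j b * Matrix.transvection i k a
  simp only [Matrix.transvection, add_mul, mul_add, one_mul, mul_one,
    Matrix.single_mul_single_same, Matrix.single_mul_single_of_ne _ _ _ _ hij.symm,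
    Matrix.single_mul_single_of_ne _ _ _ _ hkj.symm, add_zero]
  abel

/-- `SL_n(ℤ)` is perfect for `n ≥ 3`. -/
theorem commutator_int_eq_top (h3 : 3 ≤ Fintype.card ι) :
    commutator (SpecialLinearGroup ι ℤ) = ⊤ := by
  refine eq_top_of_transvection_mem fun i j hij c => ?_
  obtain ⟨k, hk⟩ : ∃ k, k ∉ ({i, j} : Finset ι) := by
    by_contra! h
    have h1 := Finset.card_le_card (fun x _ => h x : (Finset.univ : Finset ι) ⊆ {i, j})
    have h2 := Finset.card_le_two (a := i) (b := j)
    rw [Finset.card_univ] at h1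
    omega
  simp only [Finset.mem_insert, Finset.mem_singleton, not_or] at hk
  rw [← one_mul c, ← commutatorElement_transvection (Ne.symm hk.1) hk.2 hij]
  exact Subgroup.commutator_mem_commutator (Subgroup.mem_top (transvection (Ne.symm hk.1) 1))
    (Subgroup.mem_top (transvection hk.2 c))

end Matrix.SpecialLinearGroup

/-! ### Special affine groups: translations and matrices -/

namespace SAff

variable {n : ℕ} {R : Type*} [CommRing R]

theorem mem_iff {g : (Fin n → R) ≃ᵃ[R] (Fin n → R)} :
    g ∈ SAff n R ↔ LinearMap.det (g.linear : (Fin n → R) →ₗ[R] (Fin n → R)) = 1 := by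
  rw [SAff, MonoidHom.mem_ker, MonoidHom.comp_apply, Units.ext_iff, LinearEquiv.coe_det]
  rfl

/-- The translation by a vector. -/
def translation (v : Fin n → R) : ↥(SAff n R) :=
  ⟨AffineEquiv.constVAdd R (Fin n → R) v, mem_iff.2 (by
    rw [AffineEquiv.linear_constVAdd]; exact LinearMap.det_id (M := Fin n → R))⟩

theorem translation_apply (v u : Fin n → R) : (translation v).1 u = v + u := rfl

/-- The linear transformation with the given matrix. -/
def ofMatrix : Matrix.SpecialLinearGroup (Fin n) R →* ↥(SAff n R) where
  toFun A := ⟨(Matrix.SpecialLinearGroup.toLin' A).toAffineEquiv, mem_iff.2 (by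
    change LinearMap.det (Matrix.toLin' (A : Matrix (Fin n) (Fin n) R)) = 1
    rw [LinearMap.det_toLin', A.det_coe])⟩
  map_one' := Subtype.ext (AffineEquiv.ext fun u => by
    exact Matrix.one_mulVec u)
  map_mul' A B := Subtype.ext (AffineEquiv.ext fun u => by
    exact (Matrix.mulVec_mulVec u (A : Matrix (Fin n) (Fin n) R) B).symm)

theorem ofMatrix_apply (A : Matrix.SpecialLinearGroup (Fin n) R) (u : Fin n → R) :
    (ofMatrix A).1 u = (A : Matrix (Fin n) (Fin n) R).mulVec u := rfl

theorem mul_apply (g h : ↥(SAff n R)) (u : Fin n → R) : (g * h).1 u = g.1 (h.1 u) := rfl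

theorem ext {g h : ↥(SAff n R)} (H : ∀ u, g.1 u = h.1 u) : g = h :=
  Subtype.ext (AffineEquiv.ext H)

theorem ofMatrix_transvection_apply {i j : Fin n} (h : i ≠ j) (c : R) (u : Fin n → R) :
    (ofMatrix (Matrix.SpecialLinearGroup.transvection h c)).1 u = u + Pi.single i (c * u j) := by
  rw [ofMatrix_apply, Matrix.SpecialLinearGroup.transvection_coe h c, Matrix.add_mulVec,
    Matrix.one_mulVec, Matrix.single_mulVec_eq]
  congr 1
  ext k
  simp [Pi.single_apply]

theorem exists_eq_translation_mul_ofMatrix (g : ↥(SAff n R)) :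
    ∃ v A, g = translation v * ofMatrix A := by
  have hdet : (LinearMap.toMatrix' (g.1.linear : (Fin n → R) →ₗ[R] (Fin n → R))).det = 1 := by
    rw [LinearMap.det_toMatrix']
    exact mem_iff.1 g.2
  refine ⟨g.1 0, ⟨_, hdet⟩, ext fun u => ?_⟩
  change g.1 u = g.1 0 + (LinearMap.toMatrix' _).mulVec u
  rw [LinearMap.toMatrix'_mulVec]
  have h := g.1.map_vadd 0 u
  rw [vadd_eq_add, vadd_eq_add, add_zero] at h
  rw [h, add_comm]
  rfl

theorem commutatorElement_ofMatrix_translation (A : Matrix.SpecialLinearGroup (Fin n) R)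
    (v : Fin n → R) : ⁅ofMatrix A, translation v⁆ =
      translation ((A : Matrix (Fin n) (Fin n) R).mulVec v - v) := by
  rw [commutatorElement_def, mul_inv_eq_iff_eq_mul, mul_inv_eq_iff_eq_mul]
  refine ext fun u => ?_
  simp only [mul_apply, translation_apply, ofMatrix_apply, Matrix.mulVec_add]
  abel

theorem translation_add (v w : Fin n → R) :
    translation (v + w) = translation v * translation w :=
  ext fun u => by simp only [mul_apply, translation_apply, add_assoc]

/-- `SAff_n(ℤ)` is perfect for `n ≥ 3`. -/
theorem commutator_int_eq_top (hn : 3 ≤ n) : commutator ↥(SAff n ℤ) = ⊤ := by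
  have hlin : ∀ A, ofMatrix A ∈ commutator ↥(SAff n ℤ) := by
    intro A
    have h : A ∈ commutator (Matrix.SpecialLinearGroup (Fin n) ℤ) := by
      rw [Matrix.SpecialLinearGroup.commutator_int_eq_top (by simpa using hn)]
      exact Subgroup.mem_top _
    have h2 := Subgroup.mem_map_of_mem (ofMatrix (n := n) (R := ℤ)) h
    rw [commutator_def, Subgroup.map_commutator] at h2
    exact Subgroup.commutator_mono le_top le_top h2
  have hsingle : ∀ i (c : ℤ), translation (Pi.single i c) ∈ commutator ↥(SAff n ℤ) := by
    intro i c
    obtain ⟨j, hj⟩ : ∃ j : Fin n, i ≠ j := by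
      by_cases h : i.1 = 0
      · exact ⟨⟨1, by omega⟩, fun h' => by rw [h'] at h; simp at h⟩
      · exact ⟨⟨0, by omega⟩, fun h' => h (by rw [h'])⟩
    -- The transvection moves `c e_j` by `c e_i`, so its commutator with the translation by `c e_j`
    -- is the translation by `c e_i`.
    have h := Subgroup.commutator_mem_commutator
      (Subgroup.mem_top (ofMatrix (Matrix.SpecialLinearGroup.transvection hj (1 : ℤ))))
      (Subgroup.mem_top (translation (Pi.single j c)))
    rw [commutatorElement_ofMatrix_translation, ← ofMatrix_apply, ofMatrix_transvection_apply,
      add_sub_cancel_left, Pi.single_eq_same, one_mul] at h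
    exact h
  have htrans : ∀ v, translation v ∈ commutator ↥(SAff n ℤ) := by
    intro v
    rw [← Finset.univ_sum_single v]
    refine Finset.sum_induction _ (fun v => translation v ∈ commutator ↥(SAff n ℤ)) ?_ ?_
      fun i _ => hsingle i _
    · intro v w hv hw
      rw [translation_add]
      exact mul_mem hv hw
    · rw [show translation (0 : Fin n → ℤ) = 1 from ext fun u => zero_add u]
      exact one_mem _
  refine eq_top_iff.2 fun g _ => ?_
  obtain ⟨v, A, rfl⟩ := exists_eq_translation_mul_ofMatrix g
  exact mul_mem (htrans v) (hlin A)

end SAff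

/-! ## The action of `SAff_n(ℤ)` on `T_{p,n}` -/

section AffineAction

variable {p n : ℕ} [NeZero p]

theorem affineHom_smul (g : ↥(SAff n ℤ)) (w : List (Alphabet p n)) :
    affineHom p n g • w = digitWord p w.length (g.1 (wordValue w)) := rfl

theorem affineHom_smul_digitWord (g : ↥(SAff n ℤ)) (ℓ : ℕ) (u : Fin n → ℤ) :
    affineHom p n g • digitWord p ℓ u = digitWord p ℓ (g.1 u) :=
  affineAct_digitWord p g.1 ℓ u

/-- The carry rule in base `p`: the first digit depends on `c` alone, and the quotient of `c` by `p`
is carried over to the remaining digits. -/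
theorem exists_digitWord_succ_add (c : Fin n → ℤ) :
    ∃ y : Alphabet p n, ∀ (ℓ : ℕ) (u : Fin n → ℤ),
      digitWord p (ℓ + 1) (c + (p : ℤ) • u) = y :: digitWord p ℓ ((fun i => c i / (p : ℤ)) + u) := by
  have hp : (p : ℤ) ≠ 0 := by exact_mod_cast NeZero.ne p
  refine ⟨(digitWord p 1 c).head (List.cons_ne_nil _ _), fun ℓ u => ?_⟩
  have h2 : (fun i => (c + (p : ℤ) • u) i / (p : ℤ)) = (fun i => c i / (p : ℤ)) + u := by
    funext i
    simp only [Pi.add_apply, Pi.smul_apply, smul_eq_mul]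
    rw [Int.add_mul_ediv_left _ _ hp]
  rw [digitWord, h2]
  simp only [digitWord, Pi.add_apply, Pi.smul_apply, smul_eq_mul, Int.add_mul_emod_self_left,
    List.head_cons]

/-- The states of an affine transformation at the letters are affine transformations. -/
theorem affineHom_smul_cons (g : ↥(SAff n ℤ)) (x : Alphabet p n) :
    ∃ (y : Alphabet p n) (h : ↥(SAff n ℤ)), ∀ w : List (Alphabet p n),
      affineHom p n g • (x :: w) = y :: (affineHom p n h • w) := by
  obtain ⟨v, A, rfl⟩ := SAff.exists_eq_translation_mul_ofMatrix g
  set c : Fin n → ℤ := (SAff.translation v * SAff.ofMatrix A).1 fun i => ((x i : ℕ) : ℤ) with hc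
  obtain ⟨y, hy⟩ := exists_digitWord_succ_add (p := p) c
  refine ⟨y, SAff.translation (fun i => c i / (p : ℤ)) * SAff.ofMatrix A, fun w => ?_⟩
  -- From `g(x + p w) = g(x) + p A w`, the section keeps the linear part `A` and translates by the
  -- carry of `c = g(x)`.
  have h : (SAff.translation v * SAff.ofMatrix A).1 (wordValue (x :: w)) =
      c + (p : ℤ) • (SAff.ofMatrix A).1 (wordValue w) := by
    simp only [hc, wordValue, SAff.mul_apply, SAff.translation_apply, SAff.ofMatrix_apply,
      Matrix.mulVec_add, Matrix.mulVec_smul, add_assoc]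
  rw [affineHom_smul, affineHom_smul, h, List.length_cons, hy, SAff.mul_apply,
    SAff.translation_apply]

theorem exists_affineHom_smul_eq {v w : List (Alphabet p n)} (h : v.length = w.length) :
    ∃ g : ↥(SAff n ℤ), affineHom p n g • v = w := by
  refine ⟨SAff.translation (wordValue w - wordValue v), ?_⟩
  rw [affineHom_smul, SAff.translation_apply, sub_add_cancel, h, digitWord_wordValue]

/-- With `x i ≠ 0` and `j ≠ i`, the map `u ↦ u + (u i - x i) e_j` fixes `x` and sends `0` to `-x i
e_j`, which is nonzero modulo `p` since `0 < x i < p`. -/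
theorem exists_affineHom_fix_move (hn : 2 ≤ n) {x : Alphabet p n} (hx : x ≠ 0) :
    ∃ g : ↥(SAff n ℤ), affineHom p n g • [x] = [x] ∧ affineHom p n g • [0] ≠ [(0 : Alphabet p n)] := by
  obtain ⟨i, hi⟩ := Function.ne_iff.1 hx
  obtain ⟨j, hj⟩ : ∃ j : Fin n, j ≠ i := by
    by_cases h : i.1 = 0
    · exact ⟨⟨1, by omega⟩, fun h' => by rw [← h'] at h; simp at h⟩
    · exact ⟨⟨0, by omega⟩, fun h' => h (by rw [← h'])⟩
  have key : ∀ u, (SAff.translation (Pi.single j (-((x i : ℕ) : ℤ))) *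
      SAff.ofMatrix (Matrix.SpecialLinearGroup.transvection hj (1 : ℤ))).1 u =
      u + Pi.single j (u i - ((x i : ℕ) : ℤ)) := by
    intro u
    rw [SAff.mul_apply, SAff.translation_apply, SAff.ofMatrix_transvection_apply, sub_eq_add_neg,
      Pi.single_add, one_mul]
    abel
  refine ⟨SAff.translation (Pi.single j (-((x i : ℕ) : ℤ))) *
    SAff.ofMatrix (Matrix.SpecialLinearGroup.transvection hj (1 : ℤ)), ?_, fun h => ?_⟩
  · rw [affineHom_smul, key]
    have h : wordValue [x] i - ((x i : ℕ) : ℤ) = 0 := by simp [wordValue]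
    rw [h, Pi.single_zero, add_zero, digitWord_wordValue]
  · rw [affineHom_smul, key] at h
    have h0 : wordValue [(0 : Alphabet p n)] = 0 := by
      funext k
      simp [wordValue]
    rw [h0] at h
    simp only [List.length_cons, List.length_nil, digitWord, List.cons.injEq, and_true] at h
    have h1 := congrArg Fin.val (congrFun h j)
    simp only [Pi.zero_apply, zero_sub, zero_add, Pi.single_eq_same, Fin.val_zero] at h1
    have hp : (0 : ℤ) < p := by exact_mod_cast Nat.pos_of_ne_zero (NeZero.ne p)
    have h2 := Int.emod_nonneg (-((x i : ℕ) : ℤ)) hp.ne'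
    have h3 : (-((x i : ℕ) : ℤ)) % (p : ℤ) = 0 := by omega
    have h4 : (p : ℤ) ∣ ((x i : ℕ) : ℤ) := (Int.dvd_neg).1 (Int.dvd_of_emod_eq_zero h3)
    have h5 : (x i : ℕ) = 0 := Nat.eq_zero_of_dvd_of_lt (by exact_mod_cast h4) (x i).2
    exact hi (Fin.ext h5)

/-- A nonzero integer `d` is not divisible by `p ^ |d|`, since `|d| < p ^ |d|`. -/
theorem digitWord_injective (hp : 2 ≤ p) {u v : Fin n → ℤ}
    (h : ∀ ℓ, digitWord p ℓ u = digitWord p ℓ v) : u = v := by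
  funext i
  by_contra hne
  have hdvd : ∀ ℓ : ℕ, (p : ℤ) ^ ℓ ∣ u i - v i := by
    intro ℓ
    obtain ⟨a, ha⟩ := wordValue_digitWord p ℓ u
    obtain ⟨b, hb⟩ := wordValue_digitWord p ℓ v
    rw [h] at ha
    refine ⟨a i - b i, ?_⟩
    have ha' := congrFun ha i
    have hb' := congrFun hb i
    simp only [Pi.add_apply, Pi.smul_apply, smul_eq_mul] at ha' hb'
    linear_combination ha' - hb'
  have h1 := Int.natAbs_dvd_natAbs.2 (hdvd (u i - v i).natAbs)
  rw [Int.natAbs_pow, Int.natAbs_natCast] at h1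
  have h2 := Nat.le_of_dvd (Int.natAbs_pos.2 (sub_ne_zero.2 hne)) h1
  exact absurd (Nat.lt_pow_self (show 1 < p by omega)) (not_lt.2 h2)

theorem affineHom_injective (hp : 2 ≤ p) : Function.Injective (affineHom p n) := by
  rw [injective_iff_map_eq_one]
  intro g hg
  refine SAff.ext fun u => digitWord_injective hp fun ℓ => ?_
  rw [← affineHom_smul_digitWord, hg, one_smul]
  rfl

theorem commutator_affineHom_range (hn : 3 ≤ n) :
    ⁅(affineHom p n).range, (affineHom p n).range⁆ = (affineHom p n).range := by
  rw [MonoidHom.range_eq_map, ← Subgroup.map_commutator, ← commutator_def,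
    SAff.commutator_int_eq_top hn]

end AffineAction

/-! ## A free subgroup of `SAff_n(ℤ)` -/

section Free

open scoped Pointwise

theorem SAff.ofMatrix_transvection_zpow_apply {n : ℕ} {i j : Fin n} (h : i ≠ j) (c k : ℤ)
    (u : Fin n → ℤ) :
    ((SAff.ofMatrix (Matrix.SpecialLinearGroup.transvection h c)) ^ k).1 u =
      u + Pi.single i (k * c * u j) := by
  induction k generalizing u with
  | zero => simp
  | succ k ih =>
    rw [zpow_add_one, SAff.mul_apply, SAff.ofMatrix_transvection_apply, ih]
    ext a
    simp only [Pi.add_apply, Pi.single_apply, if_neg h.symm]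
    split_ifs <;> ring
  | pred k ih =>
    have h1 : (SAff.ofMatrix (Matrix.SpecialLinearGroup.transvection h c))⁻¹.1 u =
        u + Pi.single i (-c * u j) := by
      rw [← map_inv, Matrix.SpecialLinearGroup.transvection_inv, SAff.ofMatrix_transvection_apply]
    rw [zpow_sub_one, SAff.mul_apply, h1, ih]
    ext a
    simp only [Pi.add_apply, Pi.single_apply, if_neg h.symm]
    split_ifs <;> ring

/-- Two opposite elementary transvections with entry `2` generate a free group of rank two. -/
theorem SAff.containsNonabelianFreeGroup_int {n : ℕ} (hn : 2 ≤ n) :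
    ContainsNonabelianFreeGroup ↥(SAff n ℤ) := by
  let _ : MulAction ↥(SAff n ℤ) (Fin n → ℤ) :=
    { smul := fun g u => g.1 u, one_smul := fun _ => rfl, mul_smul := fun _ _ _ => rfl }
  let i : Fin 2 → Fin n := Fin.castLE hn
  have hi : ∀ a, i a ≠ i (a + 1) := by
    intro a h
    have := Fin.castLE_injective hn h
    revert this
    fin_cases a <;> decide
  let f : ∀ a : Fin 2, FreeGroup Unit →* ↥(SAff n ℤ) := fun a =>
    FreeGroup.lift fun _ => SAff.ofMatrix (Matrix.SpecialLinearGroup.transvection (hi a) (2 : ℤ))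
  -- The ping-pong sets; in `Fin 2` the other index is `a + 1`. A nontrivial power adds `2k u_{a+1}`
  -- with `k ≠ 0` to the coordinate `a`, which then dominates because `2|u_{a+1}| - |u_a| >
  -- |u_{a+1}|`.
  let X : Fin 2 → Set (Fin n → ℤ) := fun a => {u | |u (i (a + 1))| < |u (i a)|}
  have hX : ∀ a u, u ∈ X a ↔ |u (i (a + 1))| < |u (i a)| := fun a u => Iff.rfl
  have h2 : ∀ a : Fin 2, a + 1 + 1 = a := by decide
  have hne : ∀ a b : Fin 2, a ≠ b → b = a + 1 := by decide
  have hinj : Function.Injective (Monoid.CoprodI.lift f) := by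
    refine Monoid.CoprodI.lift_injective_of_ping_pong f (Or.inr ⟨0, ?_⟩) X ?_ ?_ ?_
    -- With only two factors, ping-pong needs one factor with at least three elements.
    · rw [FreeGroup.freeGroupUnitEquivInt.cardinal_eq, Cardinal.mk_denumerable]
      exact Cardinal.natCast_le_aleph0
    · intro a
      refine ⟨Pi.single (i a) 1, ?_⟩
      rw [hX, Pi.single_eq_same, Pi.single_eq_of_ne (hi a).symm]
      norm_num
    · intro a b hab
      rw [hne a b hab]
      refine Set.disjoint_left.2 fun u hu hu' => ?_
      rw [hX] at hu hu'
      rw [h2] at hu'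
      exact absurd hu (not_lt.2 hu'.le)
    · intro a b hab
      rw [hne a b hab]
      refine FreeGroup.freeGroupUnitEquivInt.forall_congr_left.mpr fun k hk => ?_
      change (FreeGroup.lift fun _ => SAff.ofMatrix
        (Matrix.SpecialLinearGroup.transvection (hi a) (2 : ℤ))) (FreeGroup.of () ^ k) •
          X (a + 1) ⊆ X a
      rw [map_zpow, FreeGroup.lift_apply_of]
      have hk0 : k ≠ 0 := by
        rintro rfl
        exact hk rfl
      rintro _ ⟨u, hu, rfl⟩
      rw [hX, h2] at hu
      change (_ ^ k : ↥(SAff n ℤ)).1 u ∈ X a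
      rw [SAff.ofMatrix_transvection_zpow_apply, hX, Pi.add_apply, Pi.add_apply,
        Pi.single_eq_same, Pi.single_eq_of_ne (hi a).symm, add_zero]
      have h3 : 1 ≤ |k| := Int.one_le_abs hk0
      have h4 : |k * 2 * u (i (a + 1))| = |k| * 2 * |u (i (a + 1))| := by
        rw [abs_mul, abs_mul]; norm_num
      have h5 := abs_sub_abs_le_abs_sub (k * 2 * u (i (a + 1))) (-u (i a))
      rw [abs_neg, sub_neg_eq_add, h4, add_comm _ (u (i a))] at h5
      nlinarith [abs_nonneg (u (i (a + 1)))]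
  exact ⟨(Monoid.CoprodI.lift f).comp freeGroupEquivCoprodI.toMonoidHom,
    hinj.comp freeGroupEquivCoprodI.injective⟩

end Free

/-! ## Automorphisms supported on a subtree -/

section Graft

variable {X : Type*}

theorem treeAut_smul_append (α : TreeAut X) (v w : List X) :
    ∃ u, u.length = w.length ∧ α • (v ++ w) = α • v ++ u := by
  induction w using List.reverseRecOn with
  | nil => exact ⟨[], rfl, by simp⟩
  | append_singleton w x ih =>
    obtain ⟨u, hu, h⟩ := ih
    obtain ⟨y, hy⟩ := treeAut_append α (v ++ w) x
    refine ⟨u ++ [y], by simp [hu], ?_⟩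
    rw [← List.append_assoc, hy, h, List.append_assoc]

theorem treeAut_smul_prefix_iff (α : TreeAut X) {v w : List X} : α • v <+: α • w ↔ v <+: w := by
  have h : ∀ (α : TreeAut X) {v w : List X}, v <+: w → α • v <+: α • w := by
    rintro α v _ ⟨w, rfl⟩
    obtain ⟨u, -, hu⟩ := treeAut_smul_append α v w
    exact ⟨u, hu.symm⟩
  refine ⟨fun hp => ?_, h α⟩
  simpa using h α⁻¹ hp

theorem TreeAut.ext_cons {α β : TreeAut X} (h : ∀ x (w : List X), α • (x :: w) = β • (x :: w)) :
    α = β := by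
  refine TreeAut.ext_smul fun v => ?_
  cases v with
  | nil => rw [treeAut_nil, treeAut_nil]
  | cons x w => exact h x w

variable [DecidableEq X]

/-- The action on words of the automorphism with state `α` at the letter `x`, trivial on the first
level and on the other subtrees. -/
def graftLetterFun (x : X) (α : TreeAut X) : List X → List X
  | [] => []
  | y :: w => if y = x then y :: (α • w) else y :: w

theorem graftLetterFun_mul (x : X) (α β : TreeAut X) (v : List X) :
    graftLetterFun x (α * β) v = graftLetterFun x α (graftLetterFun x β v) := by
  cases v with
  | nil => rfl
  | cons y w =>
    by_cases h : y = x
    · simp [graftLetterFun, h, mul_smul]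
    · simp [graftLetterFun, h]

theorem graftLetterFun_one (x : X) (v : List X) : graftLetterFun x 1 v = v := by
  cases v with
  | nil => rfl
  | cons y w => simp [graftLetterFun]

theorem graftLetterFun_dropLast (x : X) (α : TreeAut X) (v : List X) :
    graftLetterFun x α v.dropLast = (graftLetterFun x α v).dropLast := by
  cases v with
  | nil => rfl
  | cons y w =>
    by_cases hw : w = []
    · subst hw
      simp only [graftLetterFun, List.dropLast_singleton]
      split_ifs <;> simp [treeAut_nil]
    · have h1 : α • w ≠ [] := fun h => hw (List.length_eq_zero_iff.1
        (by rw [← treeAut_length α, h]; rfl))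
      rw [List.dropLast_cons_of_ne_nil hw]
      simp only [graftLetterFun]
      split_ifs
      · rw [List.dropLast_cons_of_ne_nil h1, treeAut_dropLast]
      · rw [List.dropLast_cons_of_ne_nil hw]

/-- The embedding of `Aut(T_X)` that lets an automorphism act on the subtree at the letter `x`. -/
def graftLetter (x : X) : TreeAut X →* TreeAut X where
  toFun α := TreeAut.mk' (graftLetterFun x α) (graftLetterFun x α⁻¹)
    (fun v => by rw [← graftLetterFun_mul, inv_mul_cancel, graftLetterFun_one])
    (fun v => by rw [← graftLetterFun_mul, mul_inv_cancel, graftLetterFun_one])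
    (graftLetterFun_dropLast x α)
  map_one' := TreeAut.ext_smul fun v => graftLetterFun_one x v
  map_mul' α β := TreeAut.ext_smul fun v => graftLetterFun_mul x α β v

theorem graftLetter_smul_cons_self (x : X) (α : TreeAut X) (w : List X) :
    graftLetter x α • (x :: w) = x :: (α • w) := by
  change graftLetterFun x α (x :: w) = _
  simp [graftLetterFun]

theorem graftLetter_smul_cons_of_ne {x y : X} (h : y ≠ x) (α : TreeAut X) (w : List X) :
    graftLetter x α • (y :: w) = y :: w := by
  change graftLetterFun x α (y :: w) = _
  simp [graftLetterFun, h]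

theorem graftLetter_commute {x y : X} (h : x ≠ y) (α β : TreeAut X) :
    Commute (graftLetter x α) (graftLetter y β) := by
  refine TreeAut.ext_cons fun z w => ?_
  rw [mul_smul, mul_smul]
  by_cases hx : z = x
  · subst hx
    rw [graftLetter_smul_cons_of_ne h, graftLetter_smul_cons_self, graftLetter_smul_cons_of_ne h]
  · by_cases hy : z = y
    · subst hy
      rw [graftLetter_smul_cons_self, graftLetter_smul_cons_of_ne hx,
        graftLetter_smul_cons_of_ne hx, graftLetter_smul_cons_self]
    · rw [graftLetter_smul_cons_of_ne hy, graftLetter_smul_cons_of_ne hx,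
        graftLetter_smul_cons_of_ne hy]

theorem tildeHom_smul_cons_base {o : X} (ω : BoundarySeq X o) (α : TreeAut X) (w : List X) :
    tildeHom ω α • (o :: w) = o :: (tildeHom ω.shift α • w) := by
  change tildeFun α ω (o :: w) = o :: tildeFun α ω.shift w
  simp [tildeFun]

theorem tildeHom_smul_cons_head {o : X} (ω : BoundarySeq X o) (α : TreeAut X) (w : List X) :
    tildeHom ω α • ((ω 0 : X) :: w) = (ω 0 : X) :: (α • w) := by
  change tildeFun α ω ((ω 0 : X) :: w) = _
  simp [tildeFun, (ω 0).2]

theorem tildeHom_smul_cons_of_ne {o x : X} (ω : BoundarySeq X o) (α : TreeAut X) (h1 : x ≠ o)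
    (h2 : x ≠ ω 0) (w : List X) : tildeHom ω α • (x :: w) = x :: w := by
  change tildeFun α ω (x :: w) = _
  simp [tildeFun, h1, h2]

theorem tildeHom_eq {o : X} (ω : BoundarySeq X o) (α : TreeAut X) :
    tildeHom ω α = graftLetter o (tildeHom ω.shift α) * graftLetter (ω 0 : X) α := by
  refine TreeAut.ext_cons fun x w => ?_
  rw [mul_smul]
  by_cases h1 : x = o
  · subst h1
    rw [tildeHom_smul_cons_base, graftLetter_smul_cons_of_ne (ω 0).2.symm,
      graftLetter_smul_cons_self]
  · by_cases h2 : x = ω 0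
    · subst h2
      rw [tildeHom_smul_cons_head, graftLetter_smul_cons_self, graftLetter_smul_cons_of_ne h1]
    · rw [tildeHom_smul_cons_of_ne ω α h1 h2, graftLetter_smul_cons_of_ne h2,
        graftLetter_smul_cons_of_ne h1]

theorem conj_graftLetter {g k : TreeAut X} {x y : X} (h : ∀ w : List X, g • (x :: w) = y :: (k • w))
    (α : TreeAut X) : g * graftLetter x α * g⁻¹ = graftLetter y (k * α * k⁻¹) := by
  rw [mul_inv_eq_iff_eq_mul]
  refine TreeAut.ext_cons fun z w => ?_
  rw [mul_smul, mul_smul]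
  by_cases hz : z = x
  · subst hz
    rw [graftLetter_smul_cons_self, h, h, graftLetter_smul_cons_self, mul_smul, mul_smul,
      inv_smul_smul]
  · rw [graftLetter_smul_cons_of_ne hz]
    obtain ⟨u, -, hu⟩ := treeAut_smul_append g [z] w
    obtain ⟨z', hz'⟩ := treeAut_append g [] z
    rw [treeAut_nil, List.nil_append] at hz'
    rw [List.nil_append] at hz'
    rw [hz', List.singleton_append, List.singleton_append] at hu
    rw [hu, graftLetter_smul_cons_of_ne]
    rintro rfl
    have h1 := h []
    rw [show k • ([] : List X) = [] from treeAut_nil k, ← hz'] at h1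
    exact hz (List.singleton_injective (smul_left_cancel g h1)).symm

/-- The embedding of `Aut(T_X)` that lets an automorphism act on the subtree at the word `v`. -/
def graft : List X → TreeAut X →* TreeAut X
  | [] => MonoidHom.id _
  | x :: v => (graftLetter x).comp (graft v)

theorem graft_smul_append (v : List X) (α : TreeAut X) (w : List X) :
    graft v α • (v ++ w) = v ++ α • w := by
  induction v with
  | nil => rfl
  | cons x v ih =>
    change graftLetter x (graft v α) • (x :: (v ++ w)) = _
    rw [graftLetter_smul_cons_self, ih]
    rfl

theorem graft_smul_of_not_prefix {v u : List X} (α : TreeAut X) (h : ¬ v <+: u) :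
    graft v α • u = u := by
  induction v generalizing u with
  | nil => exact absurd (List.nil_prefix) h
  | cons x v ih =>
    change graftLetter x (graft v α) • u = u
    cases u with
    | nil => exact treeAut_nil _
    | cons y u =>
      by_cases hy : y = x
      · subst hy
        rw [graftLetter_smul_cons_self, ih]
        rwa [List.prefix_cons_inj] at h
      · rw [graftLetter_smul_cons_of_ne hy]

theorem graft_smul_self (v : List X) (α : TreeAut X) : graft v α • v = v := by
  have h := graft_smul_append v α []
  rwa [treeAut_nil, List.append_nil] at h

theorem eq_graft {g k : TreeAut X} {v : List X} (h1 : ∀ w : List X, g • (v ++ w) = v ++ k • w)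
    (h2 : ∀ u, ¬ v <+: u → g • u = u) : g = graft v k := by
  refine TreeAut.ext_smul fun u => ?_
  by_cases h : v <+: u
  · obtain ⟨w, rfl⟩ := h
    rw [h1, graft_smul_append]
  · rw [h2 u h, graft_smul_of_not_prefix k h]

end Graft

/-! ## The structure of `Γ_G^Ω` -/

section Omega

variable {X : Type*} {o : X}

/-- The properties of `G` that make `Γ_G^Ω` a branch group: `G` is perfect, self-similar,
level-transitive, and the point stabilizers on the first level move the letter `o`. -/
structure IsBranchSeed (o : X) (G : Subgroup (TreeAut X)) : Prop where
  perfect : ⁅G, G⁆ = G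
  selfSimilar : ∀ g ∈ G, ∀ x : X, ∃ y, ∃ h ∈ G, ∀ w : List X, g • (x :: w) = y :: (h • w)
  transitive : ∀ v w : List X, v.length = w.length → ∃ g ∈ G, g • v = w
  moves : ∀ x, x ≠ o → ∃ g ∈ G, g • [x] = [x] ∧ g • [o] ≠ [o]

theorem IsBranchSeed.exists_section {G : Subgroup (TreeAut X)} (hG : IsBranchSeed o G)
    {g : TreeAut X} (hg : g ∈ G) {x y : X} (h : g • [x] = [y]) :
    ∃ k ∈ G, ∀ w : List X, g • (x :: w) = y :: (k • w) := by
  obtain ⟨y', k, hk, hw⟩ := hG.selfSimilar g hg x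
  have h1 := hw []
  rw [h, treeAut_nil, List.cons.injEq] at h1
  rw [h1.1]
  exact ⟨k, hk, hw⟩

variable [DecidableEq X]

theorem le_omegaGroup {G : Subgroup (TreeAut X)} {Ω : Set (BoundarySeq X o)} (hΩ : Ω.Nonempty) :
    G ≤ omegaGroup G Ω := by
  obtain ⟨ω, hω⟩ := hΩ
  exact le_sup_left.trans (le_biSup (fun ω => G ⊔ G.map (tildeHom ω)) hω)

theorem tildeHom_mem_omegaGroup {G : Subgroup (TreeAut X)} {Ω : Set (BoundarySeq X o)}
    {ω : BoundarySeq X o} (hω : ω ∈ Ω) {g : TreeAut X} (hg : g ∈ G) :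
    tildeHom ω g ∈ omegaGroup G Ω :=
  le_biSup (fun ω => G ⊔ G.map (tildeHom ω)) hω
    ((le_sup_right : _ ≤ G ⊔ G.map (tildeHom ω)) (Subgroup.mem_map_of_mem _ hg))

theorem omegaGroup_le {G K : Subgroup (TreeAut X)} {Ω : Set (BoundarySeq X o)} (h : G ≤ K)
    (h' : ∀ ω ∈ Ω, ∀ g ∈ G, tildeHom ω g ∈ K) : omegaGroup G Ω ≤ K :=
  iSup₂_le fun ω hω => sup_le h (Subgroup.map_le_iff_le_comap.2 fun g hg => h' ω hω g hg)

theorem commutator_omegaGroup {G : Subgroup (TreeAut X)} (hG : ⁅G, G⁆ = G)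
    (Ω : Set (BoundarySeq X o)) : ⁅omegaGroup G Ω, omegaGroup G Ω⁆ = omegaGroup G Ω := by
  refine le_antisymm (Subgroup.commutator_le_self _) (iSup₂_le fun ω hω => ?_)
  have h := le_biSup (fun ω => G ⊔ G.map (tildeHom ω)) hω
  refine sup_le ?_ ?_
  · conv_lhs => rw [← hG]
    exact Subgroup.commutator_mono (le_sup_left.trans h) (le_sup_left.trans h)
  · conv_lhs => rw [← hG, Subgroup.map_commutator]
    exact Subgroup.commutator_mono (le_sup_right.trans h) (le_sup_right.trans h)

namespace IsBranchSeed

variable {G : Subgroup (TreeAut X)} (hG : IsBranchSeed o G)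
include hG

/-- Conjugation by an element of `G` taking `x` to `y` moves the support and twists the label by a
section `k ∈ G`; starting from the label `k⁻¹ a k` cancels the twist. -/
theorem graftLetter_mem_of_graftLetter_mem {K Γ : Subgroup (TreeAut X)} (hGK : G ≤ K) (hGΓ : G ≤ Γ)
    {x : X} (h : ∀ a ∈ K, graftLetter x a ∈ Γ) (y : X) {a : TreeAut X} (ha : a ∈ K) :
    graftLetter y a ∈ Γ := by
  obtain ⟨g, hg, hgx⟩ := hG.transitive [x] [y] rfl
  obtain ⟨k, hk, hw⟩ := hG.exists_section hg hgx
  have h1 := conj_graftLetter hw (k⁻¹ * a * k)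
  rw [show k * (k⁻¹ * a * k) * k⁻¹ = a by group] at h1
  rw [← h1]
  exact mul_mem (mul_mem (hGΓ hg) (h _ (mul_mem (mul_mem (inv_mem (hGK hk)) ha) (hGK hk))))
    (inv_mem (hGΓ hg))

/-- The commutator trick. `tildeHom ω a` is supported at `o` and `ω 0`. A conjugate of some
`tildeHom ω b'` by an element fixing `ω 0` and moving `o` to `y` is supported at `y` and `ω 0`, with
label `b` at `ω 0`. The supports meet only at `ω 0`, so the commutator is `⁅a, b⁆` placed there; as
`G` is perfect, such elements generate all of `G` at `ω 0`. -/
theorem graftLetter_head_mem {Ω : Set (BoundarySeq X o)} {ω : BoundarySeq X o} (hω : ω ∈ Ω)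
    {a : TreeAut X} (ha : a ∈ G) : graftLetter (ω 0 : X) a ∈ omegaGroup G Ω := by
  have hle : G ≤ omegaGroup G Ω := le_omegaGroup ⟨ω, hω⟩
  obtain ⟨h, hh, h1, h2⟩ := hG.moves (ω 0) (ω 0).2
  obtain ⟨y, hy⟩ := treeAut_append h [] o
  rw [treeAut_nil, List.nil_append, List.nil_append] at hy
  obtain ⟨k, hk, hkw⟩ := hG.exists_section hh h1
  obtain ⟨k', -, hkw'⟩ := hG.exists_section hh hy
  have hyo : y ≠ o := fun e => h2 (by rw [hy, e])
  have hyω : y ≠ ω 0 := by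
    rintro rfl
    rw [← h1] at hy
    exact (ω 0).2 (List.singleton_injective (smul_left_cancel h hy)).symm
  have key : ∀ a ∈ G, ∀ b ∈ G, graftLetter (ω 0 : X) ⁅a, b⁆ ∈ omegaGroup G Ω := by
    intro a ha b hb
    have hb' : k⁻¹ * b * k ∈ G := mul_mem (mul_mem (inv_mem hk) hb) hk
    have e : h * tildeHom ω (k⁻¹ * b * k) * h⁻¹ =
        graftLetter y (k' * tildeHom ω.shift (k⁻¹ * b * k) * k'⁻¹) * graftLetter (ω 0 : X) b := by
      rw [tildeHom_eq, ← conj_graftLetter hkw',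
        show graftLetter (ω 0 : X) b = h * graftLetter (ω 0 : X) (k⁻¹ * b * k) * h⁻¹ by
          rw [conj_graftLetter hkw]; congr 1; group]
      group
    have h3 : ⁅tildeHom ω a, h * tildeHom ω (k⁻¹ * b * k) * h⁻¹⁆ ∈ omegaGroup G Ω := by
      have m1 := tildeHom_mem_omegaGroup hω ha
      have m2 : h * tildeHom ω (k⁻¹ * b * k) * h⁻¹ ∈ omegaGroup G Ω :=
        mul_mem (mul_mem (hle hh) (tildeHom_mem_omegaGroup hω hb')) (inv_mem (hle hh))
      exact mul_mem (mul_mem (mul_mem m1 m2) (inv_mem m1)) (inv_mem m2)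
    rw [e, tildeHom_eq ω a] at h3
    generalize tildeHom ω.shift a = r at h3
    generalize k' * tildeHom ω.shift (k⁻¹ * b * k) * k'⁻¹ = s at h3
    have c1 := graftLetter_commute (ω 0).2.symm r a
    have c2 := graftLetter_commute hyo.symm r s
    have c3 := graftLetter_commute (ω 0).2.symm r b
    have c4 := graftLetter_commute hyω s a
    have c5 := graftLetter_commute hyω s b
    have c6 : Commute (graftLetter y s) (graftLetter (ω 0 : X) ⁅a, b⁆) :=
      graftLetter_commute hyω s _
    have : ⁅graftLetter o r * graftLetter (ω 0 : X) a,
        graftLetter y s * graftLetter (ω 0 : X) b⁆ = graftLetter (ω 0 : X) ⁅a, b⁆ := by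
      rw [commutatorElement_mul_left_eq_conj_mul, commutatorElement_mul_right_eq_mul_conj,
        commutatorElement_mul_right_eq_mul_conj, c4.symm.commutator_eq, c2.commutator_eq,
        c3.commutator_eq, ← map_commutatorElement]
      have c7 : Commute (graftLetter o r) (graftLetter (ω 0 : X) ⁅a, b⁆) :=
        graftLetter_commute (ω 0).2.symm r _
      simp only [one_mul, mul_one, mul_inv_cancel, c6.eq, c7.eq, mul_inv_cancel_right]
    rwa [this] at h3
  have hmem : G ≤ (omegaGroup G Ω).comap (graftLetter (ω 0 : X)) := by
    conv_lhs => rw [← hG.perfect]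
    exact Subgroup.commutator_le.2 key
  exact hmem ha

/-- Dividing `tildeHom ω g` by its factor at `ω 0` leaves `tildeHom ω.shift g` placed at `o`. With
the copies of `G`, these generate the shifted group at `o`, and transitivity carries it to every
letter. -/
theorem graftLetter_mem {Ω : Set (BoundarySeq X o)} (hΩ : Ω.Nonempty) (x : X) {a : TreeAut X}
    (ha : a ∈ omegaGroup G (BoundarySeq.shift '' Ω)) : graftLetter x a ∈ omegaGroup G Ω := by
  have hle : G ≤ omegaGroup G Ω := le_omegaGroup hΩ
  have hG' : ∀ x, ∀ a ∈ G, graftLetter x a ∈ omegaGroup G Ω := by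
    obtain ⟨ω, hω⟩ := hΩ
    exact fun x a ha => hG.graftLetter_mem_of_graftLetter_mem le_rfl hle
      (fun a ha => hG.graftLetter_head_mem hω ha) x ha
  refine hG.graftLetter_mem_of_graftLetter_mem (le_omegaGroup (hΩ.image _)) hle (x := o) ?_ x ha
  refine fun a ha => (omegaGroup_le (K := (omegaGroup G Ω).comap (graftLetter o))
    (fun a ha => hG' o a ha) ?_) ha
  rintro _ ⟨ω, hω, rfl⟩ g hg
  rw [Subgroup.mem_comap, ← mul_inv_eq_iff_eq_mul.2 (tildeHom_eq ω g)]
  exact mul_mem (tildeHom_mem_omegaGroup hω hg) (inv_mem (hG' _ g hg))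

/-- The counterpart of `graftLetter_mem`. Automorphisms with all first-level sections in the shifted
group form a subgroup, so only generators need checking. -/
theorem exists_section_omegaGroup {Ω : Set (BoundarySeq X o)} (hΩ : Ω.Nonempty) {g : TreeAut X}
    (hg : g ∈ omegaGroup G Ω) (x : X) : ∃ y, ∃ k ∈ omegaGroup G (BoundarySeq.shift '' Ω),
      ∀ w : List X, g • (x :: w) = y :: (k • w) := by
  let S : Subgroup (TreeAut X) :=
    { carrier := {g | ∀ x, ∃ y, ∃ k ∈ omegaGroup G (BoundarySeq.shift '' Ω),
        ∀ w : List X, g • (x :: w) = y :: (k • w)}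
      one_mem' := fun x => ⟨x, 1, one_mem _, fun w => by simp⟩
      mul_mem' := by
        intro a b ha hb x
        obtain ⟨y, k, hk, h⟩ := hb x
        obtain ⟨z, l, hl, h'⟩ := ha y
        exact ⟨z, l * k, mul_mem hl hk, fun w => by rw [mul_smul, h, h', mul_smul]⟩
      inv_mem' := by
        intro a ha x
        obtain ⟨y, hy⟩ := treeAut_append a⁻¹ [] x
        rw [treeAut_nil, List.nil_append, List.nil_append, inv_smul_eq_iff] at hy
        obtain ⟨z, k, hk, h⟩ := ha y
        have h1 := h []
        rw [← hy, treeAut_nil, List.cons.injEq] at h1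
        refine ⟨y, k⁻¹, inv_mem hk, fun w => ?_⟩
        rw [inv_smul_eq_iff, h, smul_inv_smul, h1.1] }
  have hGS : G ≤ S := fun g hg x => by
    obtain ⟨y, h, hh, hw⟩ := hG.selfSimilar g hg x
    exact ⟨y, h, le_omegaGroup (hΩ.image _) hh, hw⟩
  refine (omegaGroup_le (K := S) hGS ?_) hg x
  intro ω hω f hf x
  by_cases h1 : x = o
  · subst h1
    exact ⟨x, _, tildeHom_mem_omegaGroup (Set.mem_image_of_mem _ hω) hf, tildeHom_smul_cons_base ω f⟩
  · by_cases h2 : x = ω 0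
    · subst h2
      exact ⟨_, f, le_omegaGroup (hΩ.image _) hf, tildeHom_smul_cons_head ω f⟩
    · exact ⟨x, 1, one_mem _, fun w => by rw [tildeHom_smul_cons_of_ne ω f h1 h2, one_smul]⟩

theorem graft_mem (v : List X) : ∀ {Ω : Set (BoundarySeq X o)}, Ω.Nonempty → ∀ {a : TreeAut X},
    a ∈ omegaGroup G ((Set.image BoundarySeq.shift)^[v.length] Ω) →
      graft v a ∈ omegaGroup G Ω := by
  induction v with
  | nil => exact fun _ _ ha => ha
  | cons x v ih => exact fun hΩ _ ha => hG.graftLetter_mem hΩ x (ih (hΩ.image _) ha)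

theorem exists_section_word (v : List X) : ∀ {Ω : Set (BoundarySeq X o)}, Ω.Nonempty →
    ∀ {g : TreeAut X}, g ∈ omegaGroup G Ω →
      ∃ k ∈ omegaGroup G ((Set.image BoundarySeq.shift)^[v.length] Ω),
        ∀ w : List X, g • (v ++ w) = g • v ++ k • w := by
  induction v with
  | nil => exact fun _ g hg => ⟨g, hg, fun w => by rw [treeAut_nil]; rfl⟩
  | cons x v ih =>
    intro Ω hΩ g hg
    obtain ⟨y, k, hk, h⟩ := hG.exists_section_omegaGroup hΩ hg x
    obtain ⟨l, hl, h'⟩ := ih (hΩ.image _) hk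
    exact ⟨l, hl, fun w => by rw [List.cons_append, h, h, h', List.cons_append]⟩

/-- On level `ℓ + 1`, `tildeHom ω g` acts as `g` at `ω 0` and, at `o`, as any `k` agreeing with
`tildeHom ω.shift g` on level `ℓ`. Induction finds `k` in the shift of the target group, and
`graftLetter_mem` admits both factors although `ω` need not belong to `Ω'`. -/
theorem exists_agree (ℓ : ℕ) : ∀ {Ω Ω' : Set (BoundarySeq X o)}, Ω.Nonempty → Ω'.Nonempty →
    ∀ {g : TreeAut X}, g ∈ omegaGroup G Ω →
      ∃ h ∈ omegaGroup G Ω', ∀ v : List X, v.length = ℓ → g • v = h • v := by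
  induction ℓ with
  | zero =>
    intro Ω Ω' _ _ g _
    refine ⟨1, one_mem _, fun v hv => ?_⟩
    rw [List.length_eq_zero_iff.1 hv, treeAut_nil, treeAut_nil]
  | succ ℓ ih =>
    intro Ω Ω' hΩ hΩ' g hg
    let S : Subgroup (TreeAut X) :=
      { carrier := {g | ∃ h ∈ omegaGroup G Ω', ∀ v : List X, v.length = ℓ + 1 → g • v = h • v}
        one_mem' := ⟨1, one_mem _, fun _ _ => rfl⟩
        mul_mem' := by
          rintro a b ⟨a', ha', ha⟩ ⟨b', hb', hb⟩
          refine ⟨a' * b', mul_mem ha' hb', fun v hv => ?_⟩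
          rw [mul_smul, mul_smul, hb v hv, ha _ (by rw [treeAut_length, hv])]
        inv_mem' := by
          rintro a ⟨a', ha', ha⟩
          refine ⟨a'⁻¹, inv_mem ha', fun v hv => ?_⟩
          rw [inv_smul_eq_iff, ha _ (by rw [treeAut_length, hv]), smul_inv_smul] }
    refine (omegaGroup_le (K := S) (fun g hg => ⟨g, le_omegaGroup hΩ' hg, fun _ _ => rfl⟩) ?_) hg
    intro ω hω g hg
    obtain ⟨k, hk, h⟩ := ih (hΩ.image _) (hΩ'.image BoundarySeq.shift)
      (tildeHom_mem_omegaGroup (Set.mem_image_of_mem BoundarySeq.shift hω) hg)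
    refine ⟨graftLetter o k * graftLetter (ω 0 : X) g, mul_mem (hG.graftLetter_mem hΩ' o hk)
      (hG.graftLetter_mem hΩ' _ (le_omegaGroup (hΩ'.image _) hg)), fun v hv => ?_⟩
    rw [tildeHom_eq, mul_smul, mul_smul]
    cases v with
    | nil => cases hv
    | cons x v =>
      by_cases hx : x = ω 0
      · subst hx
        rw [graftLetter_smul_cons_self, graftLetter_smul_cons_of_ne (ω 0).2,
          graftLetter_smul_cons_of_ne (ω 0).2]
      · rw [graftLetter_smul_cons_of_ne hx]
        by_cases hxo : x = o
        · subst hxo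
          rw [graftLetter_smul_cons_self, graftLetter_smul_cons_self, h v (by simpa using hv)]
        · rw [graftLetter_smul_cons_of_ne hxo, graftLetter_smul_cons_of_ne hxo]

theorem topologicalClosure_le {Ω Ω' : Set (BoundarySeq X o)} (hΩ : Ω.Nonempty)
    (hΩ' : Ω'.Nonempty) :
    (omegaGroup G Ω).topologicalClosure ≤ (omegaGroup G Ω').topologicalClosure := by
  refine Subgroup.topologicalClosure_minimal _ (fun g hg => ?_)
    (Subgroup.isClosed_topologicalClosure _)
  refine (mem_closure_iff_nhds_basis (treeAut_nhds_hasBasis g)).2 fun ℓ _ => ?_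
  obtain ⟨h, hh, e⟩ := hG.exists_agree ℓ hΩ hΩ' hg
  exact ⟨h, hh, fun v hv => (e v hv).symm⟩

end IsBranchSeed

end Omega

/-! ## Groups with perfect rigid stabilizers -/

theorem mem_rigidStabilizer {X G : Type*} [Group G] [MulAction G (List X)] {v : List X} {g : G} :
    g ∈ rigidStabilizer G v ↔ g • v = v ∧ ∀ u, ¬ v <+: u → g • u = u := by
  simp [rigidStabilizer, Subgroup.mem_iInf, MulAction.mem_stabilizer_iff]

/-- A strong form of the branch property: the rigid stabilizer of every vertex is perfect and acts
transitively on the levels of the subtree, and the level stabilizers are generated by rigid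
stabilizers. -/
structure IsPerfectBranch {X : Type*} (Γ : Subgroup (TreeAut X)) : Prop where
  perfect : ∀ v : List X, ⁅rigidStabilizer Γ v, rigidStabilizer Γ v⁆ = rigidStabilizer Γ v
  transitive : ∀ v u u' : List X, u.length = u'.length →
    ∃ g ∈ rigidStabilizer Γ v, g • (v ++ u) = v ++ u'
  levelStabilizer_le : ∀ ℓ, levelStabilizer X Γ ℓ ≤ rigidLevelStabilizer X Γ ℓ

theorem eq_one_of_fixes_extensions {X : Type*} {g : TreeAut X} {ℓ : ℕ}
    (hg : g ∈ levelStabilizer X (TreeAut X) ℓ)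
    (h : ∀ v : List X, v.length = ℓ → ∀ w, g • (v ++ w) = v ++ w) : g = 1 := by
  refine TreeAut.ext_smul fun u => ?_
  rw [one_smul]
  rcases le_total u.length ℓ with hu | hu
  · exact mem_levelStabilizer.1 (levelStabilizer_antitone X hu hg) u rfl
  · have h1 := h (u.take ℓ) (by simpa using hu) (u.drop ℓ)
    rwa [List.take_append_drop] at h1

/-! ### Verification of the strong branch property for `Γ_G^Ω` -/

namespace IsBranchSeed

variable {X : Type*} [DecidableEq X] {o : X} {G : Subgroup (TreeAut X)} (hG : IsBranchSeed o G)
  {Ω : Set (BoundarySeq X o)} (hΩ : Ω.Nonempty)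

include hG hΩ

theorem graft_mem_rigidStabilizer (v : List X) {a : TreeAut X}
    (ha : a ∈ omegaGroup G ((Set.image BoundarySeq.shift)^[v.length] Ω)) :
    (⟨graft v a, hG.graft_mem v hΩ ha⟩ : ↥(omegaGroup G Ω)) ∈
      rigidStabilizer (omegaGroup G Ω) v :=
  mem_rigidStabilizer.2 ⟨graft_smul_self v a, fun _ hu => graft_smul_of_not_prefix a hu⟩

/-- Combines `graft_mem` with `exists_section_word`; it lets rigid stabilizers inherit perfectness
from the shifted groups. -/
theorem map_rigidStabilizer (v : List X) :
    (rigidStabilizer (omegaGroup G Ω) v).map (omegaGroup G Ω).subtype =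
      (omegaGroup G ((Set.image BoundarySeq.shift)^[v.length] Ω)).map (graft v) := by
  ext g
  constructor
  · rintro ⟨g, hg, rfl⟩
    obtain ⟨h1, h2⟩ := mem_rigidStabilizer.1 hg
    obtain ⟨k, hk, h⟩ := hG.exists_section_word v hΩ g.2
    refine ⟨k, hk, (eq_graft (fun w => ?_) h2).symm⟩
    rw [show g.1 • v = v from h1] at h
    exact h w
  · rintro ⟨k, hk, rfl⟩
    exact ⟨_, hG.graft_mem_rigidStabilizer hΩ v hk, rfl⟩

/-- Sections are peeled off one vertex of `S` at a time: the grafted section of `g` at `v` lies in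
RiSt(v), and dividing by it makes `g` trivial below `v`. -/
theorem mem_rigidLevelStabilizer_of_fixes (ℓ : ℕ) (S : Finset (List X)) :
    ∀ g ∈ levelStabilizer X (omegaGroup G Ω) ℓ,
      (∀ v : List X, v.length = ℓ → v ∉ S → ∀ w, g • (v ++ w) = v ++ w) →
        g ∈ rigidLevelStabilizer X (omegaGroup G Ω) ℓ := by
  induction S using Finset.induction_on with
  | empty =>
    intro g hg h
    have h1 : g = 1 := Subtype.ext (eq_one_of_fixes_extensions
      (ℓ := ℓ) (mem_levelStabilizer.2 fun v hv => mem_levelStabilizer.1 hg v hv) fun v hv w => h v hv (by simp) w)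
    rw [h1]
    exact one_mem _
  | insert v S _ ih =>
    intro g hg h
    by_cases hv : v.length = ℓ
    swap
    · exact ih g hg fun u hu hS => h u hu (by
        rw [Finset.mem_insert, not_or]
        exact ⟨fun e => hv (e ▸ hu), hS⟩)
    obtain ⟨k, hk, hw⟩ := hG.exists_section_word v hΩ g.2
    rw [show g.1 • v = v from mem_levelStabilizer.1 hg v hv] at hw
    set r : ↥(omegaGroup G Ω) := ⟨graft v k, hG.graft_mem v hΩ hk⟩ with hr
    have hrv : r ∈ rigidStabilizer (omegaGroup G Ω) v := hG.graft_mem_rigidStabilizer hΩ v hk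
    have hr1 : ∀ w, r • (v ++ w) = g • (v ++ w) := fun w => by
      refine Eq.trans ?_ (hw w).symm
      exact graft_smul_append v k w
    have hr2 : ∀ u w, u.length = ℓ → u ≠ v → r • (u ++ w) = u ++ w := fun u w hu hne =>
      (mem_rigidStabilizer.1 hrv).2 _ fun hp => hne
        ((List.prefix_of_prefix_length_le (List.prefix_append u w) hp (by omega)).eq_of_length
          (by omega))
    have h1 : r⁻¹ * g ∈ rigidLevelStabilizer X (omegaGroup G Ω) ℓ := by
      refine ih _ ?_ ?_
      · rw [mem_levelStabilizer] at hg ⊢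
        intro u hu
        rw [mul_smul, hg u hu, inv_smul_eq_iff]
        by_cases huv : u = v
        · subst huv
          exact ((mem_rigidStabilizer.1 hrv).1).symm
        · have := hr2 u [] hu huv
          rw [List.append_nil] at this
          exact this.symm
      · intro u hu huS w
        rw [mul_smul, inv_smul_eq_iff]
        by_cases huv : u = v
        · subst huv
          exact (hr1 w).symm
        · rw [hr2 u w hu huv]
          exact h u hu (by rw [Finset.mem_insert, not_or]; exact ⟨huv, huS⟩) w
    have h2 : r ∈ rigidLevelStabilizer X (omegaGroup G Ω) ℓ :=
      le_biSup (fun v => rigidStabilizer (omegaGroup G Ω) v)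
        (show v ∈ {v : List X | v.length = ℓ} from hv) hrv
    have h3 := mul_mem h2 h1
    rwa [mul_inv_cancel_left] at h3

theorem isPerfectBranch [Finite X] : IsPerfectBranch (omegaGroup G Ω) where
  perfect v := by
    refine Subgroup.map_injective (Subgroup.subtype_injective (omegaGroup G Ω)) ?_
    rw [Subgroup.map_commutator, hG.map_rigidStabilizer hΩ, ← Subgroup.map_commutator,
      commutator_omegaGroup hG.perfect]
  transitive v u u' h := by
    obtain ⟨g, hg, hu⟩ := hG.transitive u u' h
    have hne : ∀ (ℓ : ℕ), ((Set.image BoundarySeq.shift)^[ℓ] Ω).Nonempty := by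
      intro ℓ
      induction ℓ with
      | zero => exact hΩ
      | succ ℓ ih =>
        rw [Function.iterate_succ_apply']
        exact ih.image _
    refine ⟨_, hG.graft_mem_rigidStabilizer hΩ v (le_omegaGroup (hne _) hg), ?_⟩
    rw [← hu]
    exact graft_smul_append v g u
  levelStabilizer_le ℓ g hg := by
    refine hG.mem_rigidLevelStabilizer_of_fixes hΩ ℓ (List.finite_length_eq X ℓ).toFinset g hg ?_
    intro v hv hv'
    exact absurd ((List.finite_length_eq X ℓ).mem_toFinset.2 hv) hv'

end IsBranchSeed

/-! ### Level actions and supports of elements -/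

section LevelAction

variable {X : Type*}

/-- `Aut(T_X)` acts on the set of vertices of level `ℓ`. -/
instance levelMulAction (ℓ : ℕ) : MulAction (TreeAut X) {v : List X // v.length = ℓ} where
  smul α v := ⟨α • v.1, (treeAut_length α v.1).trans v.2⟩
  one_smul v := Subtype.ext (one_smul _ v.1)
  mul_smul α β v := Subtype.ext (mul_smul α β v.1)

/-- The permutation representation of `G ≤ Aut(T_X)` on the level `ℓ`. -/
def levelHom (G : Subgroup (TreeAut X)) (ℓ : ℕ) :
    G →* Equiv.Perm {v : List X // v.length = ℓ} :=
  (MulAction.toPermHom (TreeAut X) _).comp G.subtype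

theorem levelHom_ker (G : Subgroup (TreeAut X)) (ℓ : ℕ) :
    (levelHom G ℓ).ker = levelStabilizer X G ℓ := by
  ext g
  rw [MonoidHom.mem_ker, mem_levelStabilizer, Equiv.ext_iff]
  exact ⟨fun h v hv => congrArg Subtype.val (h ⟨v, hv⟩), fun h v => Subtype.ext (h v.1 v.2)⟩

theorem levelHom_range_mono {G H : Subgroup (TreeAut X)} {ℓ : ℕ}
    (h : ∀ g ∈ G, ∃ k ∈ H, ∀ v : List X, v.length = ℓ → g • v = k • v) :
    (levelHom G ℓ).range ≤ (levelHom H ℓ).range := by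
  rintro _ ⟨g, rfl⟩
  obtain ⟨k, hk, e⟩ := h g.1 g.2
  exact ⟨⟨k, hk⟩, Equiv.ext fun v => Subtype.ext (e v.1 v.2).symm⟩

theorem finite_level [Finite X] (ℓ : ℕ) : Finite {v : List X // v.length = ℓ} :=
  (List.finite_length_eq X ℓ).to_subtype

theorem levelStabilizer_finiteIndex [Finite X] (G : Subgroup (TreeAut X)) (ℓ : ℕ) :
    (levelStabilizer X G ℓ).FiniteIndex := by
  have := finite_level (X := X) ℓ
  rw [← levelHom_ker]
  exact Subgroup.finiteIndex_ker _

instance levelStabilizer_normal (G : Subgroup (TreeAut X)) (ℓ : ℕ) :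
    (levelStabilizer X G ℓ).Normal := by
  rw [← levelHom_ker]
  infer_instance

theorem levelStabilizer_eq_comap (G : Subgroup (TreeAut X)) (ℓ : ℕ) :
    levelStabilizer X G ℓ = (levelStabilizer X (TreeAut X) ℓ).comap G.subtype := by
  ext g
  rw [Subgroup.mem_comap, mem_levelStabilizer, mem_levelStabilizer]
  rfl

theorem prefix_smul_iff_of_fixed (α : TreeAut X) {v : List X} (hv : α • v = v) (u : List X) :
    v <+: α • u ↔ v <+: u := by
  conv_lhs => rw [← hv]
  exact treeAut_smul_prefix_iff α

variable {Γ : Subgroup (TreeAut X)}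

theorem rigidStabilizer_commute {u w : List X} (hd : ∀ x, u <+: x → ¬ w <+: x) {r s : Γ}
    (hr : r ∈ rigidStabilizer Γ u) (hs : s ∈ rigidStabilizer Γ w) : Commute r s := by
  rw [mem_rigidStabilizer] at hr hs
  refine Subtype.ext (TreeAut.ext_smul fun x => ?_)
  change r • s • x = s • r • x
  by_cases hu : u <+: x
  · have h : u <+: r • x := (prefix_smul_iff_of_fixed r.1 hr.1 x).2 hu
    rw [hs.2 x (hd x hu), hs.2 (r • x) (hd _ h)]
  · rw [hr.2 x hu]
    by_cases hw : w <+: x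
    · rw [hr.2]
      exact fun h => hd _ h ((prefix_smul_iff_of_fixed s.1 hs.1 x).2 hw)
    · rw [hs.2 x hw, hr.2 x hu]

theorem not_prefix_of_length_eq {u w : List X} (hl : u.length = w.length) (hne : u ≠ w) (x : List X)
    (hu : u <+: x) : ¬ w <+: x := fun hw =>
  hne ((List.prefix_of_prefix_length_le hu hw hl.le).eq_of_length hl)

theorem conj_mem_rigidStabilizer (g : Γ) {v : List X} {r : Γ} (hr : r ∈ rigidStabilizer Γ v) :
    g * r * g⁻¹ ∈ rigidStabilizer Γ (g • v) := by
  rw [mem_rigidStabilizer] at hr ⊢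
  refine ⟨by rw [mul_smul, mul_smul, inv_smul_smul, hr.1], fun u hu => ?_⟩
  rw [mul_smul, mul_smul, hr.2, smul_inv_smul]
  intro h
  apply hu
  have h1 := (treeAut_smul_prefix_iff g.1).2 h
  change g • v <+: g • g⁻¹ • u at h1
  rwa [smul_inv_smul] at h1

theorem rigidStabilizer_mono {v u : List X} (h : v <+: u) :
    rigidStabilizer Γ u ≤ rigidStabilizer Γ v := by
  intro g hg
  rw [mem_rigidStabilizer] at hg ⊢
  have h1 : ∀ w, ¬ v <+: w → g • w = w := fun w hw => hg.2 w fun h' => hw (h.trans h')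
  refine ⟨?_, h1⟩
  by_cases hvu : u <+: v
  · have e : v = u := h.eq_of_length_le hvu.length_le
    rw [e]
    exact hg.1
  · exact hg.2 v hvu

theorem rigidStabilizer_le_levelStabilizer {v : List X} {ℓ : ℕ} (h : v.length = ℓ) :
    rigidStabilizer Γ v ≤ levelStabilizer X Γ ℓ := by
  intro g hg
  rw [mem_rigidStabilizer] at hg
  refine mem_levelStabilizer.2 fun u hu => ?_
  by_cases huv : v <+: u
  · rw [← huv.eq_of_length (h.trans hu.symm)]
    exact hg.1
  · exact hg.2 u huv

/-- A nontrivial element supported on two subtrees forces them to meet, hence to be nested. -/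
theorem prefix_of_mem_rigidStabilizer {u w : List X} {r : Γ} (hr1 : r ≠ 1) (hu : r ∈ rigidStabilizer Γ u)
    (hw : r ∈ rigidStabilizer Γ w) (hle : u.length ≤ w.length) : u <+: w := by
  rw [mem_rigidStabilizer] at hu hw
  by_contra h
  refine hr1 (Subtype.ext (TreeAut.ext_smul fun x => ?_))
  by_cases hx : w <+: x
  · exact hu.2 x fun hx' => h (List.prefix_of_prefix_length_le hx' hx hle)
  · exact hw.2 x hx

end LevelAction

/-! ### Normal subgroups under the strong branch property -/

namespace IsPerfectBranch

variable {X : Type*} {Γ : Subgroup (TreeAut X)} (hΓ : IsPerfectBranch Γ)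

include hΓ

/-- For `a, b` in RiSt(u), the element `g a⁻¹ g⁻¹` lives on the disjoint subtree at `g • u` and
commutes with `b`, so `⁅b, ⁅a, g⁆⁆ = ⁅b, a⁆`; perfectness finishes. Only RiSt(u) has to normalise
`N`, so the lemma also serves subgroups normal merely in a rigid stabilizer. -/
theorem rigidStabilizer_le_of_smul_ne {u : List X} {N : Subgroup Γ}
    (hN : ∀ r ∈ rigidStabilizer Γ u, ∀ g ∈ N, r * g * r⁻¹ ∈ N) {g : Γ} (hg : g ∈ N)
    (hgu : g • u ≠ u) : rigidStabilizer Γ u ≤ N := by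
  rw [← hΓ.perfect u, Subgroup.commutator_le]
  intro b hb a ha
  have hc := conj_mem_rigidStabilizer g (inv_mem ha)
  have hlen : u.length = (g • u).length := (treeAut_length g.1 u).symm
  have hcomm : Commute b (g * a⁻¹ * g⁻¹) :=
    rigidStabilizer_commute (not_prefix_of_length_eq hlen hgu.symm) hb hc
  have h1 : a * g * a⁻¹ * g⁻¹ ∈ N := mul_mem (hN a ha g hg) (inv_mem hg)
  have h2 : b * (a * g * a⁻¹ * g⁻¹) * b⁻¹ * (a * g * a⁻¹ * g⁻¹)⁻¹ ∈ N :=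
    mul_mem (hN b hb _ h1) (inv_mem h1)
  have e : b * (a * g * a⁻¹ * g⁻¹) * b⁻¹ * (a * g * a⁻¹ * g⁻¹)⁻¹ = ⁅b, a⁆ := by
    have e1 : a * g * a⁻¹ * g⁻¹ = a * (g * a⁻¹ * g⁻¹) := by group
    rw [e1]
    generalize g * a⁻¹ * g⁻¹ = c at hcomm
    calc b * (a * c) * b⁻¹ * (a * c)⁻¹ = b * a * (c * b⁻¹) * c⁻¹ * a⁻¹ := by group
      _ = b * a * (b⁻¹ * c) * c⁻¹ * a⁻¹ := by rw [hcomm.symm.inv_right.eq]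
      _ = ⁅b, a⁆ := by group
  rwa [e] at h2

theorem isLevelTransitive : IsLevelTransitive X Γ := fun v w h => by
  obtain ⟨g, -, hg⟩ := hΓ.transitive [] v w h
  exact ⟨g, hg⟩

theorem levelStabilizer_le_of_forall {ℓ : ℕ} {N : Subgroup Γ}
    (h : ∀ v : List X, v.length = ℓ → rigidStabilizer Γ v ≤ N) : levelStabilizer X Γ ℓ ≤ N :=
  (hΓ.levelStabilizer_le ℓ).trans (iSup₂_le h)

/-- The dichotomy behind just infiniteness, the congruence property and the invariance of level
stabilizers: one moved vertex of level `ℓ` gives its rigid stabilizer, and conjugation gives those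
of the whole level. -/
theorem levelStabilizer_le_of_not_le {N : Subgroup Γ} [hN : N.Normal] {ℓ : ℕ}
    (h : ¬ N ≤ levelStabilizer X Γ ℓ) : levelStabilizer X Γ ℓ ≤ N := by
  obtain ⟨g, hg, hgℓ⟩ := SetLike.not_le_iff_exists.1 h
  rw [mem_levelStabilizer] at hgℓ
  push Not at hgℓ
  obtain ⟨u, hu, hgu⟩ := hgℓ
  have h1 := hΓ.rigidStabilizer_le_of_smul_ne (fun r _ g hg => hN.conj_mem g hg r) hg hgu
  refine hΓ.levelStabilizer_le_of_forall fun v hv r hr => ?_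
  obtain ⟨t, ht⟩ := hΓ.isLevelTransitive v u (hv.trans hu.symm)
  have h2 := conj_mem_rigidStabilizer t hr
  rw [ht] at h2
  have h3 := hN.conj_mem _ (h1 h2) t⁻¹
  rwa [show t⁻¹ * (t * r * t⁻¹) * t⁻¹⁻¹ = r by group] at h3

theorem exists_levelStabilizer_le {N : Subgroup Γ} [N.Normal] (h : N ≠ ⊥) :
    ∃ ℓ, levelStabilizer X Γ ℓ ≤ N := by
  by_contra! hc
  refine h (eq_bot_iff.2 fun g hg => ?_)
  have h1 : ∀ ℓ, N ≤ levelStabilizer X Γ ℓ := fun ℓ => by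
    by_contra hN
    exact hc ℓ (hΓ.levelStabilizer_le_of_not_le hN)
  exact Subtype.ext (TreeAut.ext_smul fun v => mem_levelStabilizer.1 (h1 v.length hg) v rfl)

theorem isBranchGroup [Finite X] : IsBranchGroup X Γ := fun ℓ => by
  have := levelStabilizer_finiteIndex Γ ℓ
  exact Subgroup.finiteIndex_of_le (hΓ.levelStabilizer_le ℓ)

/-- The local version of `exists_levelStabilizer_le`: `A` moves some vertex below `v`, and RiSt(v)
is transitive on each level below `v`. -/
theorem exists_rigidStabilizer_append_le {v : List X} {A : Subgroup Γ}
    (hA : A ≤ rigidStabilizer Γ v) (hn : ∀ r ∈ rigidStabilizer Γ v, ∀ a ∈ A, r * a * r⁻¹ ∈ A)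
    (h : A ≠ ⊥) : ∃ k, ∀ u : List X, u.length = k → rigidStabilizer Γ (v ++ u) ≤ A := by
  obtain ⟨g, hg, hg1⟩ := (Subgroup.bot_or_exists_ne_one A).resolve_left h
  have hgv := mem_rigidStabilizer.1 (hA hg)
  obtain ⟨u, hu⟩ : ∃ u, g • (v ++ u) ≠ v ++ u := by
    by_contra! hc
    refine hg1 (Subtype.ext (TreeAut.ext_smul fun x => ?_))
    by_cases hx : v <+: x
    · obtain ⟨u, rfl⟩ := hx
      exact hc u
    · exact hgv.2 x hx
  have h1 := hΓ.rigidStabilizer_le_of_smul_ne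
    (fun r hr a ha => hn r (rigidStabilizer_mono (List.prefix_append v u) hr) a ha) hg hu
  refine ⟨u.length, fun u' hu' r hr => ?_⟩
  obtain ⟨t, ht, htu⟩ := hΓ.transitive v u' u hu'
  have h2 := conj_mem_rigidStabilizer t hr
  rw [htu] at h2
  have h3 := hn t⁻¹ (inv_mem ht) _ (h1 h2)
  rwa [show t⁻¹ * (t * r * t⁻¹) * t⁻¹⁻¹ = r by group] at h3

variable [Nontrivial X]

theorem rigidStabilizer_ne_bot (v : List X) : rigidStabilizer Γ v ≠ ⊥ := by
  obtain ⟨x, y, hxy⟩ := exists_pair_ne X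
  obtain ⟨g, hg, h⟩ := hΓ.transitive v [x] [y] rfl
  intro e
  rw [e, Subgroup.mem_bot] at hg
  rw [hg, one_smul, List.append_cancel_left_eq] at h
  exact hxy (List.singleton_injective h)

theorem infinite : Infinite Γ := by
  classical
  refine not_finite_iff_infinite.1 fun hfin => ?_
  obtain ⟨x, y, hxy⟩ := exists_pair_ne X
  set m := Nat.card Γ
  -- These are `Nat.card Γ + 1` distinct vertices of one level, told apart by the number of letters
  -- `x`; transitivity would need as many group elements.
  let w : Fin (m + 1) → List X := fun i => List.replicate i x ++ List.replicate (m - i) y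
  have hw : Function.Injective w := fun i j h => by
    have h1 := congrArg (List.count x) h
    simp only [w, List.count_append, List.count_replicate_self, List.count_replicate,
      beq_iff_eq, hxy.symm, if_false, add_zero] at h1
    exact Fin.ext h1
  have hlen : ∀ i, (w 0).length = (w i).length := fun i => by
    simp only [w, List.length_append, List.length_replicate, Fin.val_zero]
    omega
  choose g hg using fun i => hΓ.isLevelTransitive (w 0) (w i) (hlen i)
  have hginj : Function.Injective g := fun i j h => hw (by rw [← hg i, ← hg j, h])
  have := Nat.card_le_card_of_injective g hginj
  rw [Nat.card_fin] at this
  omega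

theorem isJustInfinite [Finite X] : IsJustInfinite Γ := by
  refine ⟨hΓ.infinite, fun N hN h => ?_⟩
  obtain ⟨ℓ, hℓ⟩ := hΓ.exists_levelStabilizer_le h
  have := levelStabilizer_finiteIndex Γ ℓ
  have := Subgroup.finiteIndex_of_le hℓ
  exact Subgroup.finite_quotient_of_finiteIndex

theorem exists_levelStabilizer_le_of_finiteIndex {N : Subgroup Γ} [N.Normal] [N.FiniteIndex] :
    ∃ ℓ, levelStabilizer X Γ ℓ ≤ N := by
  refine hΓ.exists_levelStabilizer_le ?_
  rintro rfl
  have := hΓ.infinite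
  have h := Subgroup.FiniteIndex.index_ne_zero (H := (⊥ : Subgroup Γ))
  rw [Subgroup.index_bot, Nat.card_eq_zero_of_infinite] at h
  exact h rfl

theorem exists_mem_ne_one (v : List X) : ∃ r ∈ rigidStabilizer Γ v, r ≠ 1 :=
  (Subgroup.bot_or_exists_ne_one _).resolve_left (hΓ.rigidStabilizer_ne_bot v)

theorem not_commute (v : List X) :
    ¬ ∀ a ∈ rigidStabilizer Γ v, ∀ b ∈ rigidStabilizer Γ v, Commute a b := fun h =>
  hΓ.rigidStabilizer_ne_bot v (by
    rw [← hΓ.perfect v, eq_bot_iff, Subgroup.commutator_le]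
    exact fun a ha b hb => Subgroup.mem_bot.2 (h a ha b hb).commutator_eq)

/-- If both were nontrivial, both would contain the rigid stabilizer of one common deep vertex,
which would then be abelian, contradicting `not_commute`. -/
theorem eq_bot_of_commute {v : List X} {A B : Subgroup Γ}
    (hA : A ≤ rigidStabilizer Γ v) (hnA : ∀ r ∈ rigidStabilizer Γ v, ∀ a ∈ A, r * a * r⁻¹ ∈ A)
    (hB : B ≤ rigidStabilizer Γ v) (hnB : ∀ r ∈ rigidStabilizer Γ v, ∀ a ∈ B, r * a * r⁻¹ ∈ B)
    (hAB : ∀ a ∈ A, ∀ b ∈ B, Commute a b) (h : A ≠ ⊥) : B = ⊥ := by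
  by_contra hB0
  obtain ⟨k, hk⟩ := hΓ.exists_rigidStabilizer_append_le hA hnA h
  obtain ⟨l, hl⟩ := hΓ.exists_rigidStabilizer_append_le hB hnB hB0
  obtain ⟨x⟩ : Nonempty X := inferInstance
  refine hΓ.not_commute (v ++ List.replicate (k + l) x) fun a ha b hb => hAB a ?_ b ?_
  · refine hk (List.replicate k x) (by simp) (rigidStabilizer_mono ?_ ha)
    exact ⟨List.replicate l x, by rw [List.append_assoc, List.replicate_append_replicate]⟩
  · refine hl (List.replicate l x) (by simp) (rigidStabilizer_mono ?_ hb)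
    exact ⟨List.replicate k x, by
      rw [List.append_assoc, List.replicate_append_replicate, add_comm]⟩

end IsPerfectBranch

/-! ## Isomorphisms are induced by tree automorphisms -/

theorem Subgroup.eq_of_le_of_index_eq {G : Type*} [Group G] {H K : Subgroup G} (h : H ≤ K)
    (hi : H.index = K.index) (h0 : H.index ≠ 0) : H = K := by
  have h1 := Subgroup.relIndex_mul_index h
  rw [← hi] at h1
  exact le_antisymm h (Subgroup.relIndex_eq_one.1 ((Nat.mul_eq_right h0).1 h1))

section Rigidity

variable {X : Type*}

theorem conj_mem_rigidStabilizer_of_mem_levelStabilizer {Γ : Subgroup (TreeAut X)} {ℓ : ℕ}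
    {s r : Γ} {v : List X} (hv : v.length = ℓ) (hs : s ∈ levelStabilizer X Γ ℓ)
    (hr : r ∈ rigidStabilizer Γ v) : s * r * s⁻¹ ∈ rigidStabilizer Γ v := by
  have h := conj_mem_rigidStabilizer s hr
  rwa [mem_levelStabilizer.1 hs v hv] at h

namespace IsPerfectBranch

variable {Γ₁ Γ₂ : Subgroup (TreeAut X)} (h₁ : IsPerfectBranch Γ₁)

include h₁

/-- The preimage is normal, hence comparable with the level stabilizer, and finite equal indices
turn inclusion into equality. -/
theorem comap_levelStabilizer [Finite X]
    (hi : ∀ ℓ, (levelStabilizer X Γ₁ ℓ).index = (levelStabilizer X Γ₂ ℓ).index)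
    (φ : Γ₁ ≃* Γ₂) (ℓ : ℕ) :
    (levelStabilizer X Γ₂ ℓ).comap φ.toMonoidHom = levelStabilizer X Γ₁ ℓ := by
  have e : ((levelStabilizer X Γ₂ ℓ).comap φ.toMonoidHom).index =
      (levelStabilizer X Γ₁ ℓ).index := by
    rw [Subgroup.index_comap_of_surjective _ φ.surjective, hi]
  have h0 : (levelStabilizer X Γ₁ ℓ).index ≠ 0 :=
    (levelStabilizer_finiteIndex Γ₁ ℓ).index_ne_zero
  by_cases h : (levelStabilizer X Γ₂ ℓ).comap φ.toMonoidHom ≤ levelStabilizer X Γ₁ ℓ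
  · exact Subgroup.eq_of_le_of_index_eq h e (by rwa [e])
  · exact (Subgroup.eq_of_le_of_index_eq (h₁.levelStabilizer_le_of_not_le h) e.symm h0).symm

variable (h₂ : IsPerfectBranch Γ₂) [Nontrivial X]

include h₂

/-- The subgroups `B w` commute pairwise and are normalised by RiSt(v), so at most one is nontrivial
by `eq_bot_of_commute`. One is: otherwise RiSt(v) would commute with the preimages of all RiSt(w),
which generate St(ℓ), and so would be abelian. -/
theorem exists_rigidStabilizer_le {φ : Γ₁ ≃* Γ₂} {ℓ : ℕ}
    (hφ : (levelStabilizer X Γ₂ ℓ).comap φ.toMonoidHom = levelStabilizer X Γ₁ ℓ)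
    {v : List X} (hv : v.length = ℓ) :
    ∃ w : List X, w.length = ℓ ∧ ∀ r ∈ rigidStabilizer Γ₁ v, φ r ∈ rigidStabilizer Γ₂ w := by
  have hφ' : ∀ g, φ g ∈ levelStabilizer X Γ₂ ℓ ↔ g ∈ levelStabilizer X Γ₁ ℓ := fun g => by
    rw [← hφ]
    rfl
  have hv' : ∀ r ∈ rigidStabilizer Γ₁ v, φ r ∈ levelStabilizer X Γ₂ ℓ := fun r hr =>
    (hφ' r).2 (rigidStabilizer_le_levelStabilizer hv hr)
  have hw' : ∀ w : List X, w.length = ℓ → ∀ s ∈ rigidStabilizer Γ₂ w,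
      φ.symm s ∈ levelStabilizer X Γ₁ ℓ := fun w hw s hs => by
    rw [← hφ', φ.apply_symm_apply]
    exact rigidStabilizer_le_levelStabilizer hw hs
  let B : List X → Subgroup Γ₁ := fun w =>
    rigidStabilizer Γ₁ v ⊓ (rigidStabilizer Γ₂ w).comap φ.toMonoidHom
  have hBn : ∀ w : List X, w.length = ℓ → ∀ r ∈ rigidStabilizer Γ₁ v, ∀ a ∈ B w,
      r * a * r⁻¹ ∈ B w := by
    rintro w hw r hr a ⟨ha, ha'⟩
    refine Subgroup.mem_inf.2 ⟨mul_mem (mul_mem hr ha) (inv_mem hr), ?_⟩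
    change φ (r * a * r⁻¹) ∈ rigidStabilizer Γ₂ w
    rw [map_mul, map_mul, map_inv]
    exact conj_mem_rigidStabilizer_of_mem_levelStabilizer hw (hv' r hr) ha'
  have hcomm : ∀ w : List X, w.length = ℓ → ∀ a ∈ rigidStabilizer Γ₁ v,
      ∀ b ∈ rigidStabilizer Γ₂ w, ⁅a, φ.symm b⁆ ∈ B w := by
    intro w hw a ha b hb
    refine Subgroup.mem_inf.2 ⟨?_, ?_⟩
    · have h := conj_mem_rigidStabilizer_of_mem_levelStabilizer hv (hw' w hw b hb) (inv_mem ha)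
      rw [commutatorElement_def, mul_assoc, mul_assoc, ← mul_assoc (φ.symm b)]
      exact mul_mem ha h
    · change φ ⁅a, φ.symm b⁆ ∈ rigidStabilizer Γ₂ w
      rw [map_commutatorElement, φ.apply_symm_apply]
      exact mul_mem (conj_mem_rigidStabilizer_of_mem_levelStabilizer hw (hv' a ha) hb) (inv_mem hb)
  obtain ⟨w, hw, a₀, ha₀, b₀, hb₀, hne⟩ : ∃ w : List X, w.length = ℓ ∧
      ∃ a ∈ rigidStabilizer Γ₁ v, ∃ b ∈ rigidStabilizer Γ₂ w, ¬ Commute a (φ.symm b) := by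
    by_contra! hc
    refine h₁.not_commute v fun a ha b hb => ?_
    have h : levelStabilizer X Γ₂ ℓ ≤ (Subgroup.centralizer {a}).comap φ.symm.toMonoidHom := by
      refine h₂.levelStabilizer_le_of_forall fun w hw s hs => ?_
      exact Subgroup.mem_centralizer_singleton_iff.2 (hc w hw a ha s hs).symm.eq
    have h' := Subgroup.mem_centralizer_singleton_iff.1 (h (hv' b hb))
    change φ.symm (φ b) * a = a * φ.symm (φ b) at h'
    rw [φ.symm_apply_apply] at h'
    exact h'.symm
  have hBw : B w ≠ ⊥ := fun e => hne (commutatorElement_eq_one_iff_commute.1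
    (Subgroup.mem_bot.1 (e ▸ hcomm w hw a₀ ha₀ b₀ hb₀)))
  have hcomm' : ∀ w' : List X, w'.length = ℓ → w' ≠ w → ∀ a ∈ rigidStabilizer Γ₁ v,
      ∀ b ∈ rigidStabilizer Γ₂ w', ⁅φ a, b⁆ = 1 := by
    intro w' hw' hne a ha b hb
    have h : B w' = ⊥ := by
      refine h₁.eq_bot_of_commute inf_le_left (hBn w hw) inf_le_left (hBn w' hw') ?_ hBw
      rintro a ⟨-, ha⟩ b ⟨-, hb⟩
      refine φ.injective ?_
      rw [map_mul, map_mul]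
      exact (rigidStabilizer_commute
        (not_prefix_of_length_eq (hw.trans hw'.symm) hne.symm) ha hb).eq
    have h' := hcomm w' hw' a ha b hb
    rw [h, Subgroup.mem_bot] at h'
    rw [← φ.apply_symm_apply b, ← map_commutatorElement, h', map_one]
  -- Commutators of φ(RiSt(v)) with RiSt(w') are trivial for `w' ≠ w` and lie in RiSt(w) for `w' =
  -- w`. So `T` contains all of St(ℓ), in particular φ(RiSt(v)), and perfectness of RiSt(v)
  -- concludes.
  let T : Subgroup Γ₂ :=
    { carrier := {s | s ∈ levelStabilizer X Γ₂ ℓ ∧ ∀ a ∈ rigidStabilizer Γ₁ v,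
        ⁅φ a, s⁆ ∈ rigidStabilizer Γ₂ w}
      one_mem' := ⟨one_mem _, fun a _ => by rw [commutatorElement_one_right]; exact one_mem _⟩
      mul_mem' := by
        rintro s t ⟨hs, hs'⟩ ⟨ht, ht'⟩
        refine ⟨mul_mem hs ht, fun a ha => ?_⟩
        rw [show ⁅φ a, s * t⁆ = ⁅φ a, s⁆ * (s * ⁅φ a, t⁆ * s⁻¹) by
          simp only [commutatorElement_def]; group]
        exact mul_mem (hs' a ha) (conj_mem_rigidStabilizer_of_mem_levelStabilizer hw hs (ht' a ha))
      inv_mem' := by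
        rintro s ⟨hs, hs'⟩
        refine ⟨inv_mem hs, fun a ha => ?_⟩
        rw [show ⁅φ a, s⁻¹⁆ = s⁻¹ * ⁅φ a, s⁆⁻¹ * s⁻¹⁻¹ by simp only [commutatorElement_def]; group]
        exact conj_mem_rigidStabilizer_of_mem_levelStabilizer hw (inv_mem hs) (inv_mem (hs' a ha)) }
  have hT : levelStabilizer X Γ₂ ℓ ≤ T := by
    refine h₂.levelStabilizer_le_of_forall fun w' hw' s hs => ?_
    refine ⟨rigidStabilizer_le_levelStabilizer hw' hs, fun a ha => ?_⟩
    by_cases e : w' = w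
    · subst e
      exact mul_mem (conj_mem_rigidStabilizer_of_mem_levelStabilizer hw (hv' a ha) hs) (inv_mem hs)
    · rw [hcomm' w' hw' e a ha s hs]
      exact one_mem _
  refine ⟨w, hw, ?_⟩
  change rigidStabilizer Γ₁ v ≤ (rigidStabilizer Γ₂ w).comap φ.toMonoidHom
  conv_lhs => rw [← h₁.perfect v]
  rw [Subgroup.commutator_le]
  intro a ha b hb
  change φ ⁅a, b⁆ ∈ rigidStabilizer Γ₂ w
  rw [map_commutatorElement]
  exact (hT (hv' b hb)).2 a ha

theorem exists_vertex_map [Finite X]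
    (hi : ∀ ℓ, (levelStabilizer X Γ₁ ℓ).index = (levelStabilizer X Γ₂ ℓ).index) (φ : Γ₁ ≃* Γ₂) :
    ∃ f : List X → List X, ∀ v, (f v).length = v.length ∧
      ∀ r ∈ rigidStabilizer Γ₁ v, φ r ∈ rigidStabilizer Γ₂ (f v) := by
  choose f hf using fun v : List X =>
    h₁.exists_rigidStabilizer_le h₂ (h₁.comap_levelStabilizer hi φ v.length) (v := v) rfl
  exact ⟨f, hf⟩

/-- An isomorphism between groups with perfect rigid stabilizers is induced by an automorphism of
the tree. -/
theorem exists_conj_eq [Finite X]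
    (hi : ∀ ℓ, (levelStabilizer X Γ₁ ℓ).index = (levelStabilizer X Γ₂ ℓ).index) (φ : Γ₁ ≃* Γ₂) :
    ∃ γ : TreeAut X, ∀ g : Γ₁, γ * g * γ⁻¹ = φ g := by
  obtain ⟨f, hf⟩ := h₁.exists_vertex_map h₂ hi φ
  obtain ⟨f', hf'⟩ := h₂.exists_vertex_map h₁ (fun ℓ => (hi ℓ).symm) φ.symm
  -- Nontriviality of RiSt(v) pins down its target vertex; parent compatibility and equivariance of
  -- `f` both rest on this.
  have uniq : ∀ v w : List X, w.length ≤ v.length →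
      (∀ r ∈ rigidStabilizer Γ₁ v, φ r ∈ rigidStabilizer Γ₂ w) → w <+: f v := by
    intro v w hle h
    obtain ⟨r, hr, hr1⟩ := h₁.exists_mem_ne_one v
    exact prefix_of_mem_rigidStabilizer (fun e => hr1 (φ.map_eq_one_iff.1 e)) (h r hr)
      ((hf v).2 r hr) (by rwa [(hf v).1])
  have hff' : ∀ v, f' (f v) = v := by
    intro v
    obtain ⟨r, hr, hr1⟩ := h₁.exists_mem_ne_one v
    have h1 := (hf' (f v)).2 _ ((hf v).2 r hr)
    rw [φ.symm_apply_apply] at h1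
    have hl : (f' (f v)).length = v.length := (hf' _).1.trans (hf v).1
    exact (prefix_of_mem_rigidStabilizer hr1 h1 hr hl.le).eq_of_length hl
  have hf'f : ∀ v, f (f' v) = v := by
    intro v
    obtain ⟨r, hr, hr1⟩ := h₂.exists_mem_ne_one v
    have h1 := (hf (f' v)).2 _ ((hf' v).2 r hr)
    rw [φ.apply_symm_apply] at h1
    have hl : (f (f' v)).length = v.length := (hf _).1.trans (hf' v).1
    exact (prefix_of_mem_rigidStabilizer hr1 h1 hr hl.le).eq_of_length hl
  have hdrop : ∀ v, f v.dropLast = (f v).dropLast := by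
    intro v
    have hl : (f v.dropLast).length = (f v).dropLast.length := by
      rw [(hf _).1, List.length_dropLast, List.length_dropLast, (hf _).1]
    have h1 : f v.dropLast <+: f v := by
      refine uniq v _ ?_ fun r hr => (hf _).2 r (rigidStabilizer_mono (List.dropLast_prefix v) hr)
      rw [(hf _).1, List.length_dropLast]
      omega
    exact (List.prefix_of_prefix_length_le h1 (List.dropLast_prefix _) hl.le).eq_of_length hl
  refine ⟨TreeAut.mk' f f' hff' hf'f hdrop, fun g => ?_⟩
  rw [mul_inv_eq_iff_eq_mul]
  refine TreeAut.ext_smul fun v => ?_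
  rw [mul_smul, mul_smul]
  change f (g • v) = φ g • f v
  have hl : (φ g • f v).length = (g • v).length :=
    (treeAut_length (φ g).1 _).trans ((hf v).1.trans (treeAut_length g.1 v).symm)
  -- Equivariance: φ maps RiSt(g • v) = g RiSt(v) g⁻¹ into RiSt(φ g • f v), so the latter vertex is
  -- `f (g • v)`.
  refine ((uniq _ _ hl.le fun r hr => ?_).eq_of_length (hl.trans (hf _).1.symm)).symm
  have h1 := conj_mem_rigidStabilizer g⁻¹ hr
  rw [inv_smul_smul] at h1
  have h2 := conj_mem_rigidStabilizer (φ g) ((hf v).2 _ h1)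
  rwa [← map_inv, ← map_mul, ← map_mul, show g * (g⁻¹ * r * g⁻¹⁻¹) * g⁻¹ = r by group] at h2

theorem exists_map_conj_eq [Finite X]
    (hi : ∀ ℓ, (levelStabilizer X Γ₁ ℓ).index = (levelStabilizer X Γ₂ ℓ).index) (φ : Γ₁ ≃* Γ₂) :
    ∃ γ : TreeAut X, Γ₁.map (MulAut.conj γ).toMonoidHom = Γ₂ := by
  obtain ⟨γ, hγ⟩ := h₁.exists_conj_eq h₂ hi φ
  refine ⟨γ, le_antisymm ?_ fun g hg => ?_⟩
  · rintro _ ⟨g, hg, rfl⟩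
    change γ * g * γ⁻¹ ∈ Γ₂
    rw [hγ ⟨g, hg⟩]
    exact (φ ⟨g, hg⟩).2
  · refine ⟨φ.symm ⟨g, hg⟩, (φ.symm ⟨g, hg⟩).2, ?_⟩
    change γ * (φ.symm ⟨g, hg⟩ : Γ₁) * γ⁻¹ = g
    rw [hγ, φ.apply_symm_apply]

end IsPerfectBranch

end Rigidity

/-! ## The congruence subgroup property -/

section Congruence

theorem ProfiniteGrp.isIso_of_bijective.{u} {P Q : ProfiniteGrp.{u}} (f : P ⟶ Q)
    (hf : Function.Bijective f) : IsIso f := by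
  have : IsIso ((forget ProfiniteGrp).map f) := (isIso_iff_bijective _).2 hf
  exact isIso_of_reflects_iso f (forget ProfiniteGrp)

theorem isOpen_levelStabilizer {X : Type*} (ℓ : ℕ) :
    IsOpen (levelStabilizer X (TreeAut X) ℓ : Set (TreeAut X)) := by
  refine Subgroup.isOpen_of_mem_nhds _ (g := 1) ?_
  refine ((treeAut_nhds_hasBasis 1).mem_iff).2 ⟨ℓ, trivial, fun g hg => ?_⟩
  exact mem_levelStabilizer.2 fun v hv => (hg v hv).trans (one_smul _ v)

variable {X : Type*} [Finite X]

theorem treeRes_etaFn (G : Subgroup (TreeAut X)) (g : G) :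
    treeRes G (ProfiniteGrp.ProfiniteCompletion.etaFn (GrpCat.of G) g) =
      (⟨g, G.le_topologicalClosure g.2⟩ : G.topologicalClosure) :=
  ConcreteCategory.congr_hom (ProfiniteGrp.ProfiniteCompletion.lift_eta (toTreeCompletion G)) g

/-- The image is compact, hence closed, and it contains the dense subgroup `G`. -/
theorem treeRes_surjective (G : Subgroup (TreeAut X)) : Function.Surjective (treeRes G) := by
  have hclosed : IsClosed (Set.range (treeRes G)) :=
    (isCompact_range (treeRes G).hom.continuous_toFun).isClosed
  have hdense : DenseRange (treeRes G) := by
    intro y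
    have hG : (G : Set (TreeAut X)) ⊆
        (Subtype.val : G.topologicalClosure → TreeAut X) '' Set.range (treeRes G) := fun g hg =>
      ⟨_, ⟨ProfiniteGrp.ProfiniteCompletion.etaFn (GrpCat.of G) ⟨g, hg⟩, treeRes_etaFn G ⟨g, hg⟩⟩, rfl⟩
    exact closure_subtype.2 (closure_mono hG (Subtype.prop (p := (· ∈ G.topologicalClosure)) y))
  exact Set.range_eq_univ.1 (hdense.closure_range ▸ hclosed.closure_eq.symm)

/-- Near an element `x` of the kernel there is some `g ∈ G` with the same image in `G ⧸ N` and with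
tree image in St(ℓ). As St(ℓ) lies in `N`, that image is trivial, for every `N`. -/
theorem treeRes_injective {G : Subgroup (TreeAut X)}
    (h : ∀ N : FiniteIndexNormalSubgroup G, ∃ ℓ, levelStabilizer X G ℓ ≤ N.toSubgroup) :
    Function.Injective (treeRes G) := by
  refine (injective_iff_map_eq_one (treeRes G).hom.toMonoidHom).2 fun x hx => ?_
  refine ProfiniteGrp.limit_ext _ x 1 fun N => ?_
  obtain ⟨ℓ, hℓ⟩ := h N
  let Q := (ProfiniteGrp.ProfiniteCompletion.diagram (GrpCat.of G)).obj N
  let π : profCompletion G ⟶ Q :=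
    (ProfiniteGrp.limitCone (ProfiniteGrp.ProfiniteCompletion.diagram (GrpCat.of G))).π.app N
  have hfin : Finite Q := inferInstanceAs (Finite (G ⧸ N.toSubgroup))
  have hopen₁ : IsOpen (π ⁻¹' {π x}) := (isOpen_discrete {π x}).preimage π.hom.continuous_toFun
  let res : profCompletion G → TreeAut X := fun y => Subtype.val (p := (· ∈ G.topologicalClosure))
    (treeRes G y)
  have hres : Continuous res := continuous_subtype_val.comp (treeRes G).hom.continuous_toFun
  have hopen₂ := (isOpen_levelStabilizer (X := X) ℓ).preimage hres
  have hx1 : res x = 1 := congrArg (Subtype.val (p := (· ∈ G.topologicalClosure))) hx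
  obtain ⟨g, hg₁, hg₂⟩ :=
    (ProfiniteGrp.ProfiniteCompletion.denseRange (GrpCat.of G)).exists_mem_open
      (hopen₁.inter hopen₂) ⟨x, rfl, by
        change res x ∈ levelStabilizer X (TreeAut X) ℓ
        rw [hx1]
        exact one_mem _⟩
  have hgℓ : (g : G) ∈ levelStabilizer X G ℓ := by
    rw [levelStabilizer_eq_comap]
    have e : res (ProfiniteGrp.ProfiniteCompletion.etaFn (GrpCat.of G) g) = Subtype.val (g : G) :=
      congrArg (Subtype.val (p := (· ∈ G.topologicalClosure))) (treeRes_etaFn G g)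
    have hmem : res (ProfiniteGrp.ProfiniteCompletion.etaFn (GrpCat.of G) g) ∈
        levelStabilizer X (TreeAut X) ℓ := hg₂
    rw [e] at hmem
    exact hmem
  have h1 : π (ProfiniteGrp.ProfiniteCompletion.etaFn (GrpCat.of G) g) = π x := hg₁
  refine Eq.trans h1.symm ?_
  exact (QuotientGroup.eq_one_iff (N := N.toSubgroup) (g : G)).2 (hℓ hgℓ)

theorem hasCSP_of_levelStabilizer_le {G : Subgroup (TreeAut X)}
    (h : ∀ N : FiniteIndexNormalSubgroup G, ∃ ℓ, levelStabilizer X G ℓ ≤ N.toSubgroup) :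
    HasCSP G :=
  ProfiniteGrp.isIso_of_bijective _ ⟨treeRes_injective h, treeRes_surjective G⟩

/-- The inclusion of tree completions. -/
def treeCompletionInclusion {G H : Subgroup (TreeAut X)}
    (h : G.topologicalClosure ≤ H.topologicalClosure) : treeCompletion G ⟶ treeCompletion H :=
  ProfiniteGrp.ofHom
    { toMonoidHom := Subgroup.inclusion h
      continuous_toFun := continuous_inclusion h }

theorem isIso_treeCompletionInclusion {G H : Subgroup (TreeAut X)}
    (h : G.topologicalClosure = H.topologicalClosure) :
    IsIso (treeCompletionInclusion h.le) :=
  ProfiniteGrp.isIso_of_bijective _ ⟨Subgroup.inclusion_injective h.le,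
    fun y => ⟨Subgroup.inclusion h.ge y, rfl⟩⟩

/-- Naturality of `treeRes`: when three sides of this square are isomorphisms, so is the map of
profinite completions. -/
theorem profCompletionMap_comp_treeRes {G H : Subgroup (TreeAut X)} (h : G ≤ H) :
    profCompletionMap (Subgroup.inclusion h) ≫ treeRes H =
      treeRes G ≫ treeCompletionInclusion (Subgroup.topologicalClosure_mono h) := by
  refine ProfiniteGrp.ProfiniteCompletion.lift_unique _ _ ?_
  refine ConcreteCategory.hom_ext _ _ fun g => ?_
  change treeRes H (profCompletionMap (Subgroup.inclusion h)
      (ProfiniteGrp.ProfiniteCompletion.etaFn (GrpCat.of G) g)) =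
    treeCompletionInclusion (Subgroup.topologicalClosure_mono h)
      (treeRes G (ProfiniteGrp.ProfiniteCompletion.etaFn (GrpCat.of G) g))
  have h1 : profCompletionMap (Subgroup.inclusion h)
      (ProfiniteGrp.ProfiniteCompletion.etaFn (GrpCat.of G) g) =
        ProfiniteGrp.ProfiniteCompletion.etaFn (GrpCat.of H) (Subgroup.inclusion h g) :=
    ConcreteCategory.congr_hom (ProfiniteGrp.ProfiniteCompletion.lift_eta
      (GrpCat.ofHom (Subgroup.inclusion h) ≫ ProfiniteGrp.ProfiniteCompletion.eta (GrpCat.of H))) g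
  rw [h1, treeRes_etaFn, treeRes_etaFn]
  rfl

theorem isIso_profCompletionMap_inclusion {G H : Subgroup (TreeAut X)} (h : G ≤ H)
    (hc : G.topologicalClosure = H.topologicalClosure) (hG : HasCSP G) (hH : HasCSP H) :
    IsIso (profCompletionMap (Subgroup.inclusion h)) := by
  have : IsIso (treeRes G) := hG
  have : IsIso (treeRes H) := hH
  have : IsIso (treeCompletionInclusion (Subgroup.topologicalClosure_mono h)) :=
    isIso_treeCompletionInclusion hc
  have : IsIso (profCompletionMap (Subgroup.inclusion h) ≫ treeRes H) := by
    rw [profCompletionMap_comp_treeRes]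
    infer_instance
  exact IsIso.of_isIso_comp_right _ (treeRes H)

theorem nonempty_profCompletion_iso {G H : Subgroup (TreeAut X)}
    (hc : G.topologicalClosure = H.topologicalClosure) (hG : HasCSP G) (hH : HasCSP H) :
    Nonempty (profCompletion G ≅ profCompletion H) := by
  have : IsIso (treeRes G) := hG
  have : IsIso (treeRes H) := hH
  have : IsIso (treeCompletionInclusion hc.le) := isIso_treeCompletionInclusion hc
  exact ⟨asIso (treeRes G) ≪≫ asIso (treeCompletionInclusion hc.le) ≪≫ (asIso (treeRes H)).symm⟩

end Congruence

/-! ## The groups `Γ_{p,n}^Ω` -/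

section Affine

variable {p n : ℕ} [NeZero p]

theorem affineHom_range_isBranchSeed (hn : 3 ≤ n) :
    IsBranchSeed (0 : Alphabet p n) (affineHom p n).range where
  perfect := commutator_affineHom_range hn
  selfSimilar := by
    rintro _ ⟨g, rfl⟩ x
    obtain ⟨y, h, hw⟩ := affineHom_smul_cons g x
    exact ⟨y, _, ⟨h, rfl⟩, hw⟩
  transitive v w h := by
    obtain ⟨g, hg⟩ := exists_affineHom_smul_eq h
    exact ⟨_, ⟨g, rfl⟩, hg⟩
  moves x hx := by
    obtain ⟨g, h1, h2⟩ := exists_affineHom_fix_move (show 2 ≤ n by omega) hx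
    exact ⟨_, ⟨g, rfl⟩, h1, h2⟩

theorem affineOmegaGroup_isPerfectBranch (hn : 3 ≤ n) {Ω : Set (SeqSpace p n)} (hΩ : Ω.Nonempty) :
    IsPerfectBranch (affineOmegaGroup Ω) :=
  (affineHom_range_isBranchSeed hn).isPerfectBranch hΩ

theorem affineOmegaGroup_topologicalClosure_eq (hn : 3 ≤ n) {Ω₁ Ω₂ : Set (SeqSpace p n)}
    (hΩ₁ : Ω₁.Nonempty) (hΩ₂ : Ω₂.Nonempty) :
    (affineOmegaGroup Ω₁).topologicalClosure = (affineOmegaGroup Ω₂).topologicalClosure :=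
  le_antisymm ((affineHom_range_isBranchSeed hn).topologicalClosure_le hΩ₁ hΩ₂)
    ((affineHom_range_isBranchSeed hn).topologicalClosure_le hΩ₂ hΩ₁)

/-- The index is the order of the permutation group induced on level `ℓ`, which by `exists_agree` is
the same for both sets. -/
theorem affineOmegaGroup_levelStabilizer_index_eq (hn : 3 ≤ n) {Ω₁ Ω₂ : Set (SeqSpace p n)}
    (hΩ₁ : Ω₁.Nonempty) (hΩ₂ : Ω₂.Nonempty) (ℓ : ℕ) :
    (levelStabilizer (Alphabet p n) (affineOmegaGroup Ω₁) ℓ).index =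
      (levelStabilizer (Alphabet p n) (affineOmegaGroup Ω₂) ℓ).index := by
  have hG := affineHom_range_isBranchSeed (p := p) hn
  have e : (levelHom (affineOmegaGroup Ω₁) ℓ).range = (levelHom (affineOmegaGroup Ω₂) ℓ).range :=
    le_antisymm (levelHom_range_mono fun _ hg => hG.exists_agree ℓ hΩ₁ hΩ₂ hg)
      (levelHom_range_mono fun _ hg => hG.exists_agree ℓ hΩ₂ hΩ₁ hg)
  rw [← levelHom_ker, ← levelHom_ker, Subgroup.index_ker, Subgroup.index_ker, e]

theorem affineOmegaGroup_containsNonabelianFreeGroup (hp : 2 ≤ p) (hn : 3 ≤ n)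
    {Ω : Set (SeqSpace p n)} (hΩ : Ω.Nonempty) :
    ContainsNonabelianFreeGroup (affineOmegaGroup Ω) := by
  obtain ⟨f, hf⟩ := SAff.containsNonabelianFreeGroup_int (show 2 ≤ n by omega)
  have hle : (affineHom p n).range ≤ affineOmegaGroup Ω := le_omegaGroup hΩ
  refine ⟨((Subgroup.inclusion hle).comp (affineHom p n).rangeRestrict).comp f, ?_⟩
  exact ((Subgroup.inclusion_injective hle).comp
    ((MonoidHom.rangeRestrict_injective_iff).2 (affineHom_injective hp))).comp hf

theorem affineOmegaGroup_hasCSP (hp : 2 ≤ p) (hn : 3 ≤ n) {Ω : Set (SeqSpace p n)}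
    (hΩ : Ω.Nonempty) : HasCSP (affineOmegaGroup Ω) := by
  have : Nontrivial (Fin p) := Fin.nontrivial_iff_two_le.2 hp
  have : Nonempty (Fin n) := ⟨⟨0, by omega⟩⟩
  refine hasCSP_of_levelStabilizer_le fun N => ?_
  exact (affineOmegaGroup_isPerfectBranch hn hΩ).exists_levelStabilizer_le_of_finiteIndex

end Affine


theorem mainTheorem10 (p n : ℕ) [Fact p.Prime] (hn : 3 ≤ n)
    (Ω Ω₁ Ω₂ : Set (SeqSpace p n)) (hΩ : Ω.Nonempty) (hΩ₁ : Ω₁.Nonempty) (hΩ₂ : Ω₂.Nonempty) :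
    (IsLevelTransitive (Alphabet p n) ↥(affineOmegaGroup Ω) ∧
      IsJustInfinite ↥(affineOmegaGroup Ω) ∧
      IsBranchGroup (Alphabet p n) ↥(affineOmegaGroup Ω) ∧
      ContainsNonabelianFreeGroup ↥(affineOmegaGroup Ω) ∧
      HasCSP (affineOmegaGroup Ω) ∧
      Nonempty (profCompletion ↥(affineOmegaGroup Ω) ≅ treeCompletion (affineOmegaGroup Ω)) ∧
      (affineOmegaGroup Ω₁).topologicalClosure = (affineOmegaGroup Ω₂).topologicalClosure ∧
      Nonempty (profCompletion ↥(affineOmegaGroup Ω₁) ≅ profCompletion ↥(affineOmegaGroup Ω₂))) ∧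
    (Nonempty (↥(affineOmegaGroup Ω₁) ≃* ↥(affineOmegaGroup Ω₂)) →
      ∃ γ : TreeAut (Alphabet p n),
        (affineOmegaGroup Ω₁).map (MulAut.conj γ).toMonoidHom = affineOmegaGroup Ω₂) ∧
    (∀ h : Ω₁ ⊆ Ω₂, IsIso (profCompletionMap (affineOmegaInclusion h))) := by 
  have hp : 2 ≤ p := (Fact.out : p.Prime).two_le
  have : Nontrivial (Fin p) := Fin.nontrivial_iff_two_le.2 hp
  have : Nonempty (Fin n) := ⟨⟨0, by omega⟩⟩
  have hΓ := affineOmegaGroup_isPerfectBranch hn hΩ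
  have hcsp := affineOmegaGroup_hasCSP hp hn hΩ
  have hcsp₁ := affineOmegaGroup_hasCSP hp hn hΩ₁
  have hcsp₂ := affineOmegaGroup_hasCSP hp hn hΩ₂
  have hc := affineOmegaGroup_topologicalClosure_eq hn hΩ₁ hΩ₂
  refine ⟨⟨hΓ.isLevelTransitive, hΓ.isJustInfinite, hΓ.isBranchGroup,
    affineOmegaGroup_containsNonabelianFreeGroup hp hn hΩ, hcsp, ?_, hc,
    nonempty_profCompletion_iso hc hcsp₁ hcsp₂⟩, ?_, fun h => ?_⟩
  · have : IsIso (treeRes (affineOmegaGroup Ω)) := hcsp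
    exact ⟨asIso (treeRes (affineOmegaGroup Ω))⟩
  · rintro ⟨φ⟩
    exact (affineOmegaGroup_isPerfectBranch hn hΩ₁).exists_map_conj_eq
      (affineOmegaGroup_isPerfectBranch hn hΩ₂)
      (affineOmegaGroup_levelStabilizer_index_eq hn hΩ₁ hΩ₂) φ
  · exact isIso_profCompletionMap_inclusion (omegaGroup_mono _ h) hc hcsp₁ hcsp₂
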